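/- Let $C\subseteq\mathbb{F}_2^n$ be a binary linear code that is triply-even (the Hamming weight of every codeword is divisible by $8$) and that is spanned, as an $\mathbb{F}_2$-vector space, by codewords of weight $8$. Then, up to a permutation of the positions, $C$ is a finite (possibly empty) direct sum of codes of the following forms, extended by some number $z\ge 0$ of zero positions: (i) the $2$-fold repetition $2\cdot\mathrm{Sim}_2(3)$ of the binary simplex code of dimension $3$; (ii) the binary simplex code $\mathrm{Sim}_2(4)$ of dimension $4$; (iii) the $2$-fold repetition $2\cdot\mathrm{RM}_2(4)$ of the binary first order Reed-Muller code of dimension $4$; (iv) the binary first order Reed-Muller code $\mathrm{RM}_2(5)$ of dimension $5$; (v) the $4$-fold repetition $4\cdot\mathrm{PC}_2(k)$ of the binary parity check code of some dimension $k\ge 1$. Moreover, the decomposition is essentially unique: any two such decompositions of $C$ have the same number $z$ of added zero positions, and the same summands with the same multiplicities up to order (including the dimensions $k$ in (v)). Here $\mathrm{Sim}_2(k)$ is the code of length $2^k-1$ generated by a matrix whose columns are the non-zero vectors of $\mathbb{F}_2^k$, each once; $\mathrm{RM}_2(k)$ is the code of length $2^{k-1}$ generated by the matrix whose columns are all the vectors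 of $\mathbb{F}_2^{k-1}$, extended by an all-one row; $\mathrm{PC}_2(k)=\{c\in\mathbb{F}_2^{k+1} : c_1+\dots+c_{k+1}=0\}$; the $m$-fold repetition of a code repeats every position $m$ times; and $C\oplus C'=\{(c,c') : c\in C,\ c'\in C'\}$. -/

import Mathlib

/-- A binary linear code whose positions are indexed by `ι`; a code of length `n` is a
`BinCode (Fin n)`. -/
abbrev BinCode (ι : Type) : Type := Submodule (ZMod 2) (ι → ZMod 2)

namespace BinCode

/-- Every codeword has weight divisible by `Δ`. -/
def IsDivisible {ι : Type} [Fintype ι] (Δ : ℕ) (C : BinCode ι) : Prop :=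
  ∀ c ∈ C, Δ ∣ hammingNorm c

/-- Triply-even codes are the `8`-divisible ones. -/
def IsTriplyEven {ι : Type} [Fintype ι] (C : BinCode ι) : Prop :=
  C.IsDivisible 8

/-- The code is spanned by its codewords of weight `w`. -/
def IsSpannedByWeight {ι : Type} [Fintype ι] (w : ℕ) (C : BinCode ι) : Prop :=
  Submodule.span (ZMod 2) {c : ι → ZMod 2 | c ∈ C ∧ hammingNorm c = w} = C

/-- Isomorphism of binary codes: some bijection of the positions carries one code onto the
other. -/
def Iso {ι κ : Type} (C : BinCode ι) (D : BinCode κ) : Prop :=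
  ∃ σ : ι ≃ κ, ∀ d : κ → ZMod 2, d ∈ D ↔ (fun i => d (σ i)) ∈ C

/-- The code generated by the rows of a matrix. -/
def ofMatrix {ρ ι : Type} (G : Matrix ρ ι (ZMod 2)) : BinCode ι :=
  Submodule.span (ZMod 2) (Set.range fun r : ρ => fun i : ι => G r i)

/-- The binary simplex code of dimension `k`: the columns of the generator matrix are the nonzero
vectors of `𝔽₂ᵏ`, each taken once. -/
def simplex (k : ℕ) : BinCode {v : Fin k → ZMod 2 // v ≠ 0} :=
  ofMatrix (Matrix.of fun (r : Fin k) (v : {v : Fin k → ZMod 2 // v ≠ 0}) => v.1 r)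

/-- The binary first order Reed-Muller code of dimension `k` (for `k ≥ 2`): the columns of the
generator matrix are all vectors of `𝔽₂ᵏ⁻¹`, extended by an all-one row (the row `none`). -/
def reedMuller (k : ℕ) : BinCode (Fin (k - 1) → ZMod 2) :=
  ofMatrix (Matrix.of fun (r : Option (Fin (k - 1))) (v : Fin (k - 1) → ZMod 2) =>
    r.elim (1 : ZMod 2) v)

/-- The binary parity check code of dimension `k`, of length `k + 1`. -/
def parityCheck (k : ℕ) : BinCode (Fin (k + 1)) where
  carrier := {c | ∑ i, c i = 0}
  add_mem' := by
    intro a b ha hb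
    simp only [Set.mem_ofPred_eq] at ha hb
    simp [Finset.sum_add_distrib, ha, hb]
  zero_mem' := by simp
  smul_mem' := by
    intro t a ha
    simp only [Set.mem_ofPred_eq] at ha
    simp [← Finset.mul_sum, ha]

/-- The `m`-fold repetition of a code. -/
def repetition {ι : Type} (m : ℕ) (C : BinCode ι) : BinCode (Fin m × ι) :=
  C.map (LinearMap.funLeft (ZMod 2) (ZMod 2) (Prod.snd : Fin m × ι → ι))

/-- The direct sum of finitely many codes, on the disjoint union of their positions. -/
def directSum {r : ℕ} {ι : Fin r → Type} (C : (s : Fin r) → BinCode (ι s)) :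
    BinCode ((s : Fin r) × ι s) :=
  ⨅ s : Fin r, (C s).comap (LinearMap.funLeft (ZMod 2) (ZMod 2) (Sigma.mk s))

/-- The extension of a code by `z` zero positions. -/
def zeroExtend {ι : Type} (z : ℕ) (C : BinCode ι) : BinCode (ι ⊕ Fin z) :=
  C.comap (LinearMap.funLeft (ZMod 2) (ZMod 2) Sum.inl) ⊓
    LinearMap.ker (LinearMap.funLeft (ZMod 2) (ZMod 2) (Sum.inr : Fin z → ι ⊕ Fin z))

end BinCode

/-- The list of building blocks of triply-even codes; `parity k` stands for one code for every
dimension `k ≥ 1`. -/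
inductive TriplyEvenBlock : Type
  | twiceSimplexThree
  | simplexFour
  | twiceReedMullerFour
  | reedMullerFive
  | fourTimesParity (k : ℕ) (hk : 1 ≤ k)

namespace TriplyEvenBlock

/-- The positions of the code of a building block. -/
def Pos : TriplyEvenBlock → Type
  | twiceSimplexThree => Fin 2 × {v : Fin 3 → ZMod 2 // v ≠ 0}
  | simplexFour => {v : Fin 4 → ZMod 2 // v ≠ 0}
  | twiceReedMullerFour => Fin 2 × (Fin (4 - 1) → ZMod 2)
  | reedMullerFive => Fin (5 - 1) → ZMod 2
  | fourTimesParity k _ => Fin 4 × Fin (k + 1)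

/-- The code of a building block. -/
def code : (t : TriplyEvenBlock) → BinCode t.Pos
  | twiceSimplexThree => (BinCode.simplex 3).repetition 2
  | simplexFour => BinCode.simplex 4
  | twiceReedMullerFour => (BinCode.reedMuller 4).repetition 2
  | reedMullerFive => BinCode.reedMuller 5
  | fourTimesParity k _ => (BinCode.parityCheck k).repetition 4

end TriplyEvenBlock

/-- `C` is isomorphic to the direct sum of the codes of the blocks `T 0, …, T (r - 1)`, extended by
`z` zero positions. -/
def BinCode.DecomposesAs {ι : Type} (C : BinCode ι) {r : ℕ} (T : Fin r → TriplyEvenBlock)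
    (z : ℕ) : Prop :=
  C.Iso ((BinCode.directSum fun s => (T s).code).zeroExtend z)

/-! Existence rests on one local fact: two distinct codewords of weight 8 in a triply-even code meet
in 0 or 4 positions. Call a subcode block-like if it is a nonzero equidistant code of weight 8, or
an equidistant code of dimension at least 2 together with a word of weight 16 covering it, or the
even sums of at least five disjoint words of weight 4. If a codeword of weight 8 outside a
block-like subcode meets it, adjoining that word gives a block-like code again
(`IsBlockLike.isBlockLike_sup_span`). A block-like subcode of maximal dimension is therefore
disjoint from every codeword of weight 8 outside it, so it splits off as a direct summand
(`exists_splitting`), and induction on the dimension decomposes the code.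

Block-like codes are defined through weights alone, so the MacWilliams extension theorem
(`exists_embedding`) identifies each of them, up to zero positions, with the listed code having the
same weights. Equidistant codes have dimension 1, 2, 3 or 4, which gives `4·PC(1)`, `4·PC(2)`,
`2·Sim(3)`, `Sim(4)`. Adding a covering word to dimension 2, 3, 4 gives `4·PC(3)`, `2·RM(4)`,
`RM(5)`. The third kind is `4·PC(k)` with `k ≥ 4`.

For uniqueness, the partition of the positions is intrinsic. Any two positions of a block share a
codeword of weight 8, and such a codeword cannot spread over several blocks, because its restriction
to each block again has weight divisible by 8 (`IsPlacedFamily.mem_range_of_linked`). The type of a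
block is then recovered from its length and from which positions no codeword separates
(`TriplyEvenBlock.eq_of_equiv`). The number `z` counts the positions where the whole code vanishes.
-/

namespace BinCode

/-! ### Weights and intersections of binary words -/

section Weight

variable {ι κ : Type} [Fintype ι] [Fintype κ]

theorem hammingNorm_eq_sum_val (x : ι → ZMod 2) : hammingNorm x = ∑ i, (x i).val := by
  rw [hammingNorm, Finset.card_filter]
  refine Finset.sum_congr rfl fun i _ => ?_
  generalize x i = t
  revert t
  decide

theorem hammingNorm_add_add (x y : ι → ZMod 2) :
    hammingNorm (x + y) + 2 * hammingNorm (x * y) = hammingNorm x + hammingNorm y := by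
  simp only [hammingNorm_eq_sum_val, Finset.mul_sum, ← Finset.sum_add_distrib, Pi.add_apply,
    Pi.mul_apply]
  refine Finset.sum_congr rfl fun i _ => ?_
  generalize x i = s
  generalize y i = t
  revert s t
  decide

theorem hammingNorm_add_of_mul_eq_zero {x y : ι → ZMod 2} (h : x * y = 0) :
    hammingNorm (x + y) = hammingNorm x + hammingNorm y := by
  simpa [h] using hammingNorm_add_add x y

theorem mul_self_word {ι : Type} (x : ι → ZMod 2) : x * x = x := by
  ext i
  rw [Pi.mul_apply]
  generalize x i = s
  revert s
  decide

theorem add_self_word {ι : Type} (x : ι → ZMod 2) : x + x = 0 := by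
  ext i
  exact CharTwo.add_self_eq_zero _

theorem add_eq_zero_word {ι : Type} {x y : ι → ZMod 2} : x + y = 0 ↔ x = y := by
  constructor
  · intro h
    have : x + y + y = y := by rw [h, zero_add]
    rwa [add_assoc, add_self_word, add_zero] at this
  · rintro rfl
    exact add_self_word x

theorem hammingNorm_mul_le (x y : ι → ZMod 2) : hammingNorm (x * y) ≤ hammingNorm x := by
  refine Finset.card_le_card fun i => ?_
  simp only [Finset.mem_filter, Finset.mem_univ, true_and, Pi.mul_apply]
  exact left_ne_zero_of_mul

/-- A word covered in weight by another one is contained in it. -/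
theorem mul_eq_self_of_hammingNorm {x y : ι → ZMod 2}
    (h : hammingNorm x ≤ hammingNorm (x * y)) : x * y = x := by
  have h1 : (x * y) * (x + x * y) = 0 := by
    have : (x * y) * (x + x * y) = (x * x) * y + (x * x) * (y * y) := by ring
    rw [this, mul_self_word, mul_self_word, add_self_word]
  have h2 := hammingNorm_add_of_mul_eq_zero h1
  have h3 : x * y + (x + x * y) = x := by
    rw [add_comm x, ← add_assoc, add_self_word, zero_add]
  rw [h3] at h2
  have h4 : hammingNorm (x + x * y) = 0 := by omega
  exact (add_eq_zero_word.1 (hammingNorm_eq_zero.1 h4)).symm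

/-- The sum of the two words has weight 16 minus twice the size of the intersection; this is a
nonzero multiple of 8, hence 8 or 16. -/
theorem IsTriplyEven.hammingNorm_mul {C : BinCode ι} (hC : C.IsTriplyEven) {w c : ι → ZMod 2}
    (hw : w ∈ C) (hc : c ∈ C) (hw8 : hammingNorm w = 8) (hc8 : hammingNorm c = 8)
    (hne : w ≠ c) : hammingNorm (w * c) = 0 ∨ hammingNorm (w * c) = 4 := by
  have h1 := hammingNorm_add_add w c
  obtain ⟨k, hk⟩ := hC _ (C.add_mem hw hc)
  have h2 : hammingNorm (w + c) ≠ 0 := by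
    rw [Ne, hammingNorm_eq_zero, add_eq_zero_word]
    exact hne
  omega

end Weight

/-! ### Character sums and the MacWilliams extension theorem -/

section Characters

variable {Y : Type} [AddCommGroup Y] [Module (ZMod 2) Y] [Fintype Y]

/-- The nontrivial character of the field with two elements. -/
def sgn (t : ZMod 2) : ℤ := if t = 0 then 1 else -1

theorem sgn_add (s t : ZMod 2) : sgn (s + t) = sgn s * sgn t := by
  revert s t
  decide

theorem two_mul_val (t : ZMod 2) : 2 * (t.val : ℤ) = 1 - sgn t := by
  revert t
  decide

theorem eq_one_of_ne_zero {t : ZMod 2} (h : t ≠ 0) : t = 1 := by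
  revert t
  decide

theorem sum_sgn_eq_zero {l : Y →ₗ[ZMod 2] ZMod 2} (hl : l ≠ 0) : ∑ y, sgn (l y) = 0 := by
  obtain ⟨y₀, hy₀⟩ : ∃ y, l y ≠ 0 := by
    by_contra! h
    exact hl (LinearMap.ext h)
  have h1 : ∑ y, sgn (l y) = ∑ y, sgn (l (y + y₀)) :=
    (Equiv.sum_comp (Equiv.addRight y₀) fun y => sgn (l y)).symm
  have h2 : ∑ y, sgn (l (y + y₀)) = -∑ y, sgn (l y) := by
    rw [← Finset.sum_neg_distrib]
    refine Finset.sum_congr rfl fun y _ => ?_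
    rw [map_add, sgn_add, eq_one_of_ne_zero hy₀]
    simp [sgn]
  omega

theorem two_mul_sum_val {l : Y →ₗ[ZMod 2] ZMod 2} (hl : l ≠ 0) :
    2 * ∑ y, (l y).val = Fintype.card Y := by
  have : (2 : ℤ) * ∑ y, ((l y).val : ℤ) = Fintype.card Y := by
    simp_rw [Finset.mul_sum, two_mul_val, Finset.sum_sub_distrib, sum_sgn_eq_zero hl]
    simp
  exact_mod_cast this

variable {ι κ : Type} [Fintype ι] [Fintype κ]

/-- The functional that reads off a position of a parametrized code. -/
def column (Φ : Y →ₗ[ZMod 2] ι → ZMod 2) (i : ι) : Y →ₗ[ZMod 2] ZMod 2 :=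
  LinearMap.proj i ∘ₗ Φ

theorem column_apply {Y : Type} [AddCommGroup Y] [Module (ZMod 2) Y] {ι : Type}
    (Φ : Y →ₗ[ZMod 2] ι → ZMod 2) (i : ι) (y : Y) :
    column Φ i y = Φ y i := rfl

-- Fourier inversion of the weight function: each position contributes a multiple of `1 - sgn (Φ y
-- i)`, and orthogonality keeps only the positions whose column is `l`. Thus the weights determine
-- how often each nonzero column occurs.
open Classical in
theorem sum_sgn_mul_hammingNorm (Φ : Y →ₗ[ZMod 2] ι → ZMod 2) {l : Y →ₗ[ZMod 2] ZMod 2}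
    (hl : l ≠ 0) :
    2 * ∑ y, sgn (l y) * (hammingNorm (Φ y) : ℤ) =
      -(Fintype.card Y * Fintype.card {i // column Φ i = l}) := by
  have h1 : ∀ i, ∑ y, sgn (l y) * (1 - sgn (Φ y i)) =
      if column Φ i = l then -(Fintype.card Y : ℤ) else 0 := by
    intro i
    have h2 : ∀ y, sgn (l y) * (1 - sgn (Φ y i)) = sgn (l y) - sgn ((l + column Φ i) y) := by
      intro y
      rw [LinearMap.add_apply, sgn_add, column_apply]
      ring
    simp_rw [h2, Finset.sum_sub_distrib, sum_sgn_eq_zero hl, zero_sub]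
    split_ifs with h
    · subst h
      have : ∀ y, sgn ((column Φ i + column Φ i) y) = 1 := by
        intro y
        rw [LinearMap.add_apply, CharTwo.add_self_eq_zero]
        rfl
      simp_rw [this]
      simp
    · rw [sum_sgn_eq_zero, neg_zero]
      intro h3
      apply h
      ext y
      have := LinearMap.congr_fun h3 y
      rw [LinearMap.add_apply, LinearMap.zero_apply, CharTwo.add_eq_zero] at this
      exact this.symm
  calc 2 * ∑ y, sgn (l y) * (hammingNorm (Φ y) : ℤ)
      = ∑ y, ∑ i, sgn (l y) * (1 - sgn (Φ y i)) := by
        rw [Finset.mul_sum]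
        refine Finset.sum_congr rfl fun y _ => ?_
        rw [hammingNorm_eq_sum_val, ← Finset.mul_sum]
        simp_rw [← two_mul_val]
        rw [← Finset.mul_sum]
        push_cast
        ring
    _ = ∑ i, if column Φ i = l then -(Fintype.card Y : ℤ) else 0 := by
        rw [Finset.sum_comm]
        exact Finset.sum_congr rfl fun i _ => h1 i
    _ = _ := by
        rw [← Finset.sum_filter, Finset.sum_const, Fintype.card_subtype]
        simp [mul_comm]

/-- The extension theorem of MacWilliams: a weight preserving linear map between codes is given by
a relabelling of the positions, up to zero positions. -/
theorem exists_embedding (Φ : Y →ₗ[ZMod 2] ι → ZMod 2) (Ψ : Y →ₗ[ZMod 2] κ → ZMod 2)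
    (hw : ∀ y, hammingNorm (Φ y) = hammingNorm (Ψ y)) (hΨ : ∀ j, ∃ y, Ψ y j ≠ 0) :
    ∃ e : κ → ι, Function.Injective e ∧ (∀ y j, Φ y (e j) = Ψ y j) ∧
      ∀ y, ∀ i ∉ Set.range e, Φ y i = 0 := by
  classical
  -- Equal weights force equal multiplicities of every nonzero column. Zero columns are invisible to
  -- the weights, which is why only `Ψ` is required to have none.
  have h1 : ∀ l : Y →ₗ[ZMod 2] ZMod 2, l ≠ 0 →
      Nonempty ({j // column Ψ j = l} ≃ {i // column Φ i = l}) := by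
    intro l hl
    refine ⟨Fintype.equivOfCardEq ?_⟩
    have h2 := sum_sgn_mul_hammingNorm Φ hl
    simp_rw [hw] at h2
    rw [sum_sgn_mul_hammingNorm Ψ hl, neg_inj] at h2
    have h3 : (Fintype.card Y : ℤ) ≠ 0 := by exact_mod_cast Fintype.card_ne_zero
    exact_mod_cast mul_left_cancel₀ h3 h2
  have h2 : ∀ j, column Ψ j ≠ 0 := by
    intro j h
    obtain ⟨y, hy⟩ := hΨ j
    exact hy (LinearMap.congr_fun h y)
  have F : ∀ l : Y →ₗ[ZMod 2] ZMod 2, l ≠ 0 → ({j // column Ψ j = l} ≃ {i // column Φ i = l}) :=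
    fun l hl => (h1 l hl).some
  have key : ∀ j, column Φ (F _ (h2 j) ⟨j, rfl⟩).1 = column Ψ j := fun j => (F _ (h2 j) ⟨j, rfl⟩).2
  -- The chosen bijections are indexed by functionals; this rewrites the one attached to the column
  -- of `j` as the one attached to any `l` equal to it, so that positions with the same column can
  -- be compared.
  have aux : ∀ (l : Y →ₗ[ZMod 2] ZMod 2) (hl : l ≠ 0) (j : κ) (hj : column Ψ j = l),
      (F _ (h2 j) ⟨j, rfl⟩).1 = (F l hl ⟨j, hj⟩).1 := by
    intro l hl j hj
    subst hj
    rfl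
  refine ⟨fun j => (F _ (h2 j) ⟨j, rfl⟩).1, ?_, ?_, ?_⟩
  · intro j j' h
    have h3 : column Ψ j = column Ψ j' := by
      rw [← key j, ← key j']
      exact congrArg _ h
    dsimp only at h
    rw [aux _ (h2 j') j h3] at h
    have := (F _ (h2 j')).injective (Subtype.ext h)
    exact congrArg Subtype.val this
  · intro y j
    exact LinearMap.congr_fun (key j) y
  · intro y i hi
    by_contra hne
    have hl : column Φ i ≠ 0 := fun h => hne (LinearMap.congr_fun h y)
    apply hi
    obtain ⟨j, hj⟩ := (F _ hl).surjective ⟨i, rfl⟩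
    refine ⟨j.1, ?_⟩
    dsimp only
    rw [aux _ hl j.1 j.2, Subtype.coe_eta, hj]

end Characters

/-! ### Equidistant codes and the three block-like shapes -/

section Types

variable {ι : Type}

theorem mem_sup_span_singleton {B : BinCode ι} {c x : ι → ZMod 2} :
    x ∈ B ⊔ Submodule.span (ZMod 2) {c} ↔ ∃ b ∈ B, x = b ∨ x = b + c := by
  rw [Submodule.mem_sup]
  simp_rw [Submodule.mem_span_singleton]
  constructor
  · rintro ⟨b, hb, _, ⟨t, rfl⟩, rfl⟩
    refine ⟨b, hb, ?_⟩
    by_cases ht : t = 0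
    · left
      rw [ht, zero_smul, add_zero]
    · right
      rw [eq_one_of_ne_zero ht, one_smul]
  · rintro ⟨b, hb, h | h⟩
    · exact ⟨b, hb, 0, ⟨0, zero_smul _ _⟩, by rw [h, add_zero]⟩
    · exact ⟨b, hb, c, ⟨1, one_smul _ _⟩, h.symm⟩

variable [Fintype ι]

/-- The number of positions at which a code does not vanish. -/
noncomputable def effectiveLength (B : BinCode ι) : ℕ :=
  Set.ncard {i | ∃ w ∈ B, w i ≠ 0}

/-- Double counting: at a position where the code does not vanish, exactly half of the codewords are
1. -/
theorem two_mul_sum_hammingNorm (B : BinCode ι) [Fintype B] :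
    2 * ∑ w : B, hammingNorm w.1 = B.effectiveLength * Fintype.card B := by
  classical
  have h1 : ∀ i, 2 * ∑ w : B, (w.1 i).val =
      if ∃ w ∈ B, w i ≠ 0 then Fintype.card B else 0 := by
    intro i
    split_ifs with h
    · obtain ⟨w, hw, hwi⟩ := h
      exact two_mul_sum_val (l := column B.subtype i)
        fun h => hwi (LinearMap.congr_fun h ⟨w, hw⟩)
    · push Not at h
      rw [Finset.sum_eq_zero, mul_zero]
      intro w _
      rw [h w.1 w.2, ZMod.val_zero]
  simp_rw [hammingNorm_eq_sum_val]
  rw [Finset.sum_comm, Finset.mul_sum, Finset.sum_congr rfl fun i _ => h1 i, ← Finset.sum_filter,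
    Finset.sum_const, effectiveLength, Set.ncard_eq_toFinset_card', smul_eq_mul]
  congr 2
  ext i
  simp

/-- Every nonzero codeword has weight `8`. -/
def IsEquidistant (B : BinCode ι) : Prop :=
  ∀ w ∈ B, w ≠ 0 → hammingNorm w = 8

/-- Double counting gives `N·|B| = 16(|B| - 1)` for the effective length `N`. Hence `N < 16`, and
`|B|` divides 16, so the dimension is at most 4. -/
theorem IsEquidistant.effectiveLength_mul {B : BinCode ι} (hB : B.IsEquidistant) :
    B.effectiveLength * Nat.card B + 16 = 16 * Nat.card B := by
  classical
  have : Fintype B := Fintype.ofFinite B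
  rw [Nat.card_eq_fintype_card, ← two_mul_sum_hammingNorm]
  have h1 : ∀ w : B, hammingNorm w.1 = if w = 0 then 0 else 8 := by
    intro w
    split_ifs with h
    · rw [h]
      exact hammingNorm_zero
    · exact hB w.1 w.2 fun h' => h (Subtype.ext h')
  have h2 : ∑ w : B, hammingNorm w.1 + 8 = ∑ w : B, 8 := by
    rw [← Finset.sum_erase_add _ (fun w : B => hammingNorm w.1) (Finset.mem_univ (0 : B)),
      ← Finset.sum_erase_add _ (fun _ : B => 8) (Finset.mem_univ (0 : B)), h1 0, if_pos rfl,
      add_zero]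
    congr 1
    refine Finset.sum_congr rfl fun w hw => ?_
    rw [h1, if_neg (Finset.ne_of_mem_erase hw)]
  rw [Finset.sum_const, Finset.card_univ, smul_eq_mul] at h2
  omega

theorem IsEquidistant.effectiveLength_lt {B : BinCode ι} (hB : B.IsEquidistant) :
    B.effectiveLength < 16 := by
  have h1 := hB.effectiveLength_mul
  by_contra! h
  have := Nat.mul_le_mul_right (Nat.card B) h
  omega

/-- A word supported at positions where a code does not vanish is no longer than the code. -/
theorem hammingNorm_le_effectiveLength {B : BinCode ι} {x : ι → ZMod 2}
    (hx : ∀ i, x i ≠ 0 → ∃ w ∈ B, w i ≠ 0) : hammingNorm x ≤ B.effectiveLength := by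
  rw [effectiveLength, hammingNorm, ← Set.ncard_coe_finset]
  refine Set.ncard_le_ncard (fun i hi => hx i ?_) (Set.toFinite _)
  simpa using hi

theorem card_eq_two_pow (B : BinCode ι) :
    Nat.card B = 2 ^ Module.finrank (ZMod 2) B := by
  rw [Module.natCard_eq_pow_finrank (K := ZMod 2), Nat.card_zmod]

theorem finrank_sup_span {B : BinCode ι} {c : ι → ZMod 2} (hc : c ∉ B) :
    Module.finrank (ZMod 2) ↥(B ⊔ Submodule.span (ZMod 2) {c}) =
      Module.finrank (ZMod 2) B + 1 := by
  have h0 : c ≠ 0 := fun h => hc (h ▸ B.zero_mem)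
  have h1 := Submodule.finrank_sup_add_finrank_inf_eq B (Submodule.span (ZMod 2) {c})
  have h2 : B ⊓ Submodule.span (ZMod 2) {c} = ⊥ := by
    rw [eq_bot_iff]
    rintro x ⟨hx, hxc⟩
    obtain ⟨t, rfl⟩ := Submodule.mem_span_singleton.1 hxc
    by_cases ht : t = 0
    · simp [ht]
    · rw [eq_one_of_ne_zero ht, one_smul] at hx
      exact absurd hx hc
  rw [h2, finrank_bot, finrank_span_singleton h0] at h1
  omega

/-- An equidistant code extended by a word of weight `16` that covers it. -/
def IsReedMullerLike (B : BinCode ι) : Prop :=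
  ∃ (A : BinCode ι) (u : ι → ZMod 2), A.IsEquidistant ∧ 2 ≤ Module.finrank (ZMod 2) A ∧
    hammingNorm u = 16 ∧ (∀ w ∈ A, w * u = w) ∧ B = A ⊔ Submodule.span (ZMod 2) {u}

/-- The sums of an even number out of `k + 1 ≥ 5` disjoint words of weight `4`. -/
def IsParityLike (B : BinCode ι) : Prop :=
  ∃ k : ℕ, 4 ≤ k ∧ ∃ h : Fin (k + 1) → ι → ZMod 2, (∀ i, hammingNorm (h i) = 4) ∧
    (∀ i j, i ≠ j → h i * h j = 0) ∧
    B = (parityCheck k).map (Fintype.linearCombination (ZMod 2) h)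

/-- The codes that are permutation equivalent to one of the building blocks, up to zero
positions. -/
def IsBlockLike (B : BinCode ι) : Prop :=
  (B.IsEquidistant ∧ B ≠ ⊥) ∨ B.IsReedMullerLike ∨ B.IsParityLike

theorem IsEquidistant.sup_span {B : BinCode ι} (hB : B.IsEquidistant) {c : ι → ZMod 2}
    (hc : hammingNorm c = 8) (h4 : ∀ w ∈ B, w ≠ 0 → hammingNorm (w * c) = 4) :
    (B ⊔ Submodule.span (ZMod 2) {c}).IsEquidistant := by
  intro x hx hx0
  obtain ⟨b, hb, rfl | rfl⟩ := mem_sup_span_singleton.1 hx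
  · exact hB _ hb hx0
  · by_cases hb0 : b = 0
    · rw [hb0, zero_add, hc]
    · have := hammingNorm_add_add b c
      rw [hB b hb hb0, h4 b hb hb0, hc] at this
      omega

/-- If every nonzero codeword meets `c`, each does so in 4 positions and the extension stays
equidistant. Otherwise exactly one nonzero codeword `a` avoids `c`, and `a + c` is a word of weight
16 covering everything: any other nonzero codeword meets `a` in 4 positions and `c` in 4 further
ones. -/
theorem IsEquidistant.isBlockLike_sup_span {B : BinCode ι} (hB : B.IsEquidistant)
    {c : ι → ZMod 2} (hcB : c ∉ B) (hc : hammingNorm c = 8)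
    (hmeet : ∃ w ∈ B, w * c ≠ 0)
    (hC : (B ⊔ Submodule.span (ZMod 2) {c}).IsTriplyEven) :
    (B ⊔ Submodule.span (ZMod 2) {c}).IsBlockLike := by
  have hle : B ≤ B ⊔ Submodule.span (ZMod 2) {c} := le_sup_left
  have hcm : c ∈ B ⊔ Submodule.span (ZMod 2) {c} :=
    mem_sup_span_singleton.2 ⟨0, B.zero_mem, Or.inr (zero_add c).symm⟩
  have hf : ∀ w ∈ B, w * c ≠ 0 → hammingNorm (w * c) = 4 := by
    intro w hw hwc
    have hw0 : w ≠ 0 := by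
      rintro rfl
      exact hwc (zero_mul c)
    rcases hC.hammingNorm_mul (hle hw) hcm (hB w hw hw0) hc (fun h => hcB (h ▸ hw)) with h | h
    · exact absurd (hammingNorm_eq_zero.1 h) hwc
    · exact h
  obtain ⟨w, hw, hwc⟩ := hmeet
  by_cases hZ : ∀ a ∈ B, a ≠ 0 → a * c ≠ 0
  · left
    refine ⟨hB.sup_span hc fun a ha ha0 => hf a ha (hZ a ha ha0), ?_⟩
    intro h
    rw [h] at hcm
    exact hcB (by rw [(Submodule.mem_bot _).1 hcm]; exact B.zero_mem)
  · push Not at hZ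
    obtain ⟨a, ha, ha0, hac⟩ := hZ
    -- A second codeword `b` avoiding `c` is impossible: the union of `a` and `b` has 12 positions
    -- and `w * c` adds 4 more, exceeding the effective length, which is below 16.
    have huniq : ∀ b ∈ B, b ≠ 0 → b ≠ a → b * c ≠ 0 := by
      intro b hb hb0 hba hbc
      -- The word `a + b + a * b` is the indicator of the union of the two supports.
      have h1 : hammingNorm (a + (b + a * b)) = 12 := by
        have h2 := hammingNorm_add_add a b
        rw [hB a ha ha0, hB b hb hb0, hB (a + b) (B.add_mem ha hb)
          (fun h => hba (add_eq_zero_word.1 h).symm)] at h2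
        have h3 : b * (a * b) = a * b := by
          rw [mul_comm a b, ← mul_assoc, mul_self_word]
        have h4 := hammingNorm_add_add b (a * b)
        rw [hB b hb hb0, h3] at h4
        have h5 : a * (b + a * b) = 0 := by
          rw [mul_add, ← mul_assoc, mul_self_word, add_self_word]
        rw [hammingNorm_add_of_mul_eq_zero h5, hB a ha ha0]
        omega
      have h2 : (a + (b + a * b)) * (w * c) = 0 := by
        have : (a + (b + a * b)) * (w * c) = a * c * w + b * c * w + a * c * (b * w) := by ring
        rw [this, hac, hbc]
        simp
      have h3 := hammingNorm_add_of_mul_eq_zero h2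
      rw [h1, hf w hw hwc] at h3
      have h4 : hammingNorm (a + (b + a * b) + w * c) ≤ B.effectiveLength := by
        apply hammingNorm_le_effectiveLength
        intro i hi
        by_contra! hall
        apply hi
        simp [hall a ha, hall b hb, hall w hw]
      have := hB.effectiveLength_lt
      omega
    right; left
    refine ⟨B, a + c, hB, ?_, ?_, ?_, ?_⟩
    · have hwa : w ≠ a := by
        rintro rfl
        exact hwc hac
      have hw0 : w ≠ 0 := by
        rintro rfl
        exact hwc (zero_mul c)
      by_contra! hlt
      have h1 := card_eq_two_pow B
      have h2 : Nat.card B ≤ 2 := by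
        rw [h1]
        calc 2 ^ _ ≤ 2 ^ 1 := Nat.pow_le_pow_right (by norm_num) (by omega)
          _ = 2 := rfl
      have h3 : ({0, a, w} : Set (ι → ZMod 2)).ncard ≤ (B : Set (ι → ZMod 2)).ncard := by
        refine Set.ncard_le_ncard ?_ (Set.toFinite _)
        rintro x (rfl | rfl | rfl)
        exacts [B.zero_mem, ha, hw]
      rw [Set.ncard_eq_three.2 ⟨0, a, w, ha0.symm, hw0.symm, hwa.symm, rfl⟩] at h3
      have h4 : Nat.card B = (B : Set (ι → ZMod 2)).ncard := rfl
      omega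
    · rw [hammingNorm_add_of_mul_eq_zero hac, hB a ha ha0, hc]
    · intro b hb
      by_cases hb0 : b = 0
      · rw [hb0, zero_mul]
      apply mul_eq_self_of_hammingNorm
      rw [hB b hb hb0]
      by_cases hba : b = a
      · rw [hba, mul_add, hac, mul_self_word, add_zero, hB a ha ha0]
      · have h2 := hammingNorm_add_add b a
        rw [hB a ha ha0, hB b hb hb0, hB (b + a) (B.add_mem hb ha)
          (fun h => hba (add_eq_zero_word.1 h))] at h2
        have h3 : (b * a) * (b * c) = 0 := by
          have : (b * a) * (b * c) = a * c * (b * b) := by ring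
          rw [this, hac, zero_mul]
        rw [mul_add, hammingNorm_add_of_mul_eq_zero h3, hf b hb (huniq b hb hb0 hba)]
        omega
    · ext x
      rw [mem_sup_span_singleton, mem_sup_span_singleton]
      constructor
      · rintro ⟨b, hb, rfl | rfl⟩
        · exact ⟨x, hb, Or.inl rfl⟩
        · refine ⟨b + a, B.add_mem hb ha, Or.inr ?_⟩
          rw [add_assoc, ← add_assoc a a c, add_self_word, zero_add]
      · rintro ⟨b, hb, rfl | rfl⟩
        · exact ⟨x, hb, Or.inl rfl⟩
        · exact ⟨b + a, B.add_mem hb ha, Or.inr (add_assoc b a c).symm⟩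

end Types

/-! ### Adjoining a word to the other two shapes -/

section Steps

variable {ι : Type} [Fintype ι]

theorem hammingNorm_eq_ncard (x : ι → ZMod 2) : hammingNorm x = Set.ncard {i | x i ≠ 0} := by
  rw [hammingNorm, ← Set.ncard_coe_finset]
  congr 1
  ext i
  simp

theorem mem_parityCheck {k : ℕ} {y : Fin (k + 1) → ZMod 2} :
    y ∈ parityCheck k ↔ ∑ i, y i = 0 := Iff.rfl

theorem add_add_cancel_word {ι : Type} (x y : ι → ZMod 2) : x + (y + x) = y := by
  rw [add_comm y, ← add_assoc, add_self_word, zero_add]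

/-- The code lives on the 12 positions of `u` outside `v`; comparing with `N·|Z| + 16 = 16·|Z|`
yields `|Z| ≤ 4`. -/
theorem IsEquidistant.finrank_eq_two {Z : BinCode ι} (hZ : Z.IsEquidistant)
    (h2 : 2 ≤ Module.finrank (ZMod 2) Z) {u v : ι → ZMod 2} (hu : hammingNorm u = 16)
    (hv : hammingNorm v = 4) (hvu : v * u = v) (hZu : ∀ w ∈ Z, w * u = w)
    (hZv : ∀ w ∈ Z, w * v = 0) : Module.finrank (ZMod 2) Z = 2 := by
  have h1 : Z.effectiveLength + 4 ≤ 16 := by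
    rw [← hu, ← hv, hammingNorm_eq_ncard, hammingNorm_eq_ncard, effectiveLength,
      ← Set.ncard_union_eq ?_ (Set.toFinite _) (Set.toFinite _)]
    · refine Set.ncard_le_ncard ?_ (Set.toFinite _)
      rintro i (⟨w, hw, hwi⟩ | hi)
      · rw [Set.mem_ofPred_eq]
        intro h
        rw [← hZu w hw, Pi.mul_apply, h, mul_zero] at hwi
        exact hwi rfl
      · rw [Set.mem_ofPred_eq] at hi ⊢
        intro h
        rw [← hvu, Pi.mul_apply, h, mul_zero] at hi
        exact hi rfl
    · rw [Set.disjoint_left]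
      rintro i ⟨w, hw, hwi⟩ hi
      exact mul_ne_zero hwi hi (congrFun (hZv w hw) i)
  have h3 := hZ.effectiveLength_mul
  have h4 := Nat.mul_le_mul_right (Nat.card Z) h1
  have h5 : Nat.card Z < 2 ^ 3 := by
    rw [Nat.add_mul] at h4
    omega
  rw [card_eq_two_pow, Nat.pow_lt_pow_iff_right (by norm_num)] at h5
  omega

theorem exists_basis_of_finrank_eq_two {Z : BinCode ι} (h : Module.finrank (ZMod 2) Z = 2) :
    ∃ a b, a ≠ 0 ∧ b ≠ 0 ∧ a ≠ b ∧
      Z = Submodule.span (ZMod 2) {a} ⊔ Submodule.span (ZMod 2) {b} := by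
  have h1 : Z ≠ ⊥ := by
    rintro rfl
    rw [finrank_bot] at h
    omega
  obtain ⟨a, ha, ha0⟩ := Z.ne_bot_iff.1 h1
  have h2 : ¬ Z ≤ Submodule.span (ZMod 2) {a} := by
    intro hle
    have := Submodule.finrank_mono hle
    rw [h, finrank_span_singleton ha0] at this
    omega
  obtain ⟨b, hb, hba⟩ := SetLike.not_le_iff_exists.1 h2
  refine ⟨a, b, ha0, ?_, ?_, ?_⟩
  · rintro rfl
    exact hba (Submodule.zero_mem _)
  · rintro rfl
    exact hba (Submodule.mem_span_singleton_self a)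
  · symm
    apply Submodule.eq_of_le_of_finrank_eq
    · rw [sup_le_iff, Submodule.span_singleton_le_iff_mem, Submodule.span_singleton_le_iff_mem]
      exact ⟨ha, hb⟩
    · rw [finrank_sup_span hba, finrank_span_singleton ha0, h]

/-- The supports of `a`, `b`, `u`, `c` cut out five disjoint sets of size 4: `a ∩ b`, `a \ b`, `b \
a`, `u ∩ c` and `c \ u`. The four generators are sums of an even number of these, and they generate
all such sums. -/
theorem isParityLike_of_four {a b u c : ι → ZMod 2} (ha : hammingNorm a = 8)
    (hb : hammingNorm b = 8) (hab : hammingNorm (a + b) = 8) (hu : hammingNorm u = 16)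
    (hc : hammingNorm c = 8) (hau : a * u = a) (hbu : b * u = b) (hac : a * c = 0)
    (hbc : b * c = 0) (huc : hammingNorm (u * c) = 4) :
    IsParityLike (Submodule.span (ZMod 2) {a} ⊔ Submodule.span (ZMod 2) {b} ⊔
      Submodule.span (ZMod 2) {u} ⊔ Submodule.span (ZMod 2) {c}) := by
  have hab4 : hammingNorm (a * b) = 4 := by
    have := hammingNorm_add_add a b
    omega
  have pw : ∀ i, a i * u i = a i ∧ b i * u i = b i ∧ a i * c i = 0 ∧ b i * c i = 0 := fun i =>
    ⟨congrFun hau i, congrFun hbu i, congrFun hac i, congrFun hbc i⟩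
  have h1 : hammingNorm (a + a * b) = 4 := by
    have := hammingNorm_add_add a (a * b)
    rw [← mul_assoc, mul_self_word] at this
    omega
  have h2 : hammingNorm (b + a * b) = 4 := by
    have := hammingNorm_add_add b (a * b)
    rw [mul_comm a b, ← mul_assoc, mul_self_word, mul_comm b a] at this
    omega
  have h4 : hammingNorm (c + u * c) = 4 := by
    have := hammingNorm_add_add c (u * c)
    rw [mul_comm u c, ← mul_assoc, mul_self_word, mul_comm c u] at this
    omega
  -- The disjoint sets `a ∪ b` and `u ∩ c` lie inside `u` and have sizes 12 and 4, so they exhaust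
  -- it.
  have hsum : u = a + (b + a * b) + u * c := by
    have e1 : a * (b + a * b) = 0 := by
      rw [mul_add, ← mul_assoc, mul_self_word, add_self_word]
    have e2 : (a + (b + a * b)) * (u * c) = 0 := by
      have : (a + (b + a * b)) * (u * c) = a * c * u + b * c * u + a * c * (b * u) := by ring
      rw [this, hac, hbc]
      simp
    have e3 : hammingNorm (a + (b + a * b) + u * c) = 16 := by
      rw [hammingNorm_add_of_mul_eq_zero e2, hammingNorm_add_of_mul_eq_zero e1]
      omega
    have e4 : u * (a + (b + a * b) + u * c) = a + (b + a * b) + u * c := by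
      have : u * (a + (b + a * b) + u * c) = a * u + (b * u + (a * u) * b) + (u * u) * c := by
        ring
      rw [this, hau, hbu, mul_self_word]
    rw [← e4]
    exact (mul_eq_self_of_hammingNorm (by rw [e4, e3, hu])).symm
  refine ⟨4, le_rfl, ![a * b, a + a * b, b + a * b, u * c, c + u * c], ?_, ?_, ?_⟩
  · intro i
    fin_cases i
    exacts [hab4, h1, h2, huc, h4]
  · have hdec : ∀ i j : Fin 5, i ≠ j → ∀ s t v w : ZMod 2, s * v = s → t * v = t → s * w = 0 →
        t * w = 0 → ![s * t, s + s * t, t + s * t, v * w, w + v * w] i *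
          ![s * t, s + s * t, t + s * t, v * w, w + v * w] j = 0 := by
      decide
    intro i j hij
    ext p
    obtain ⟨q1, q2, q3, q4⟩ := pw p
    have := hdec i j hij _ _ _ _ q1 q2 q3 q4
    rw [Pi.mul_apply, Pi.zero_apply, ← this]
    congr 1 <;> [fin_cases i; fin_cases j] <;> rfl
  · have huc' : u * c + a * b = u + a + b := by
      have : u * c + a * b = (a + (b + a * b) + u * c) + a + b := by
        have e : (a + (b + a * b) + u * c) + a + b = (a + a) + (b + b) + (u * c + a * b) := by ring
        rw [e, add_self_word, add_self_word, zero_add, zero_add]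
      rw [this, ← hsum]
    apply le_antisymm
    · rw [sup_le_iff, sup_le_iff, sup_le_iff]
      simp_rw [Submodule.span_singleton_le_iff_mem]
      refine ⟨⟨⟨?_, ?_⟩, ?_⟩, ?_⟩
      · refine ⟨![1, 1, 0, 0, 0], mem_parityCheck.2 (by decide), ?_⟩
        rw [Fintype.linearCombination_apply, Fin.sum_univ_five]
        simp [add_add_cancel_word]
      · refine ⟨![1, 0, 1, 0, 0], mem_parityCheck.2 (by decide), ?_⟩
        rw [Fintype.linearCombination_apply, Fin.sum_univ_five]
        simp [add_add_cancel_word]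
      · refine ⟨![1, 1, 1, 1, 0], mem_parityCheck.2 (by decide), ?_⟩
        rw [Fintype.linearCombination_apply, Fin.sum_univ_five]
        conv_rhs => rw [hsum]
        simp [add_add_cancel_word]
      · refine ⟨![0, 0, 0, 1, 1], mem_parityCheck.2 (by decide), ?_⟩
        rw [Fintype.linearCombination_apply, Fin.sum_univ_five]
        simp [add_add_cancel_word]
    -- Eliminating the coefficient of `a * b` by the parity condition pairs every other piece with
    -- `a * b`; each such pair lies in the span.
    · rintro _ ⟨y, hy, rfl⟩
      have hy0 : y 0 = y 1 + y 2 + y 3 + y 4 := by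
        have : ∑ i, y i = 0 := hy
        rw [Fin.sum_univ_five] at this
        generalize y 0 = y0, y 1 = y1, y 2 = y2, y 3 = y3, y 4 = y4 at this ⊢
        revert y0 y1 y2 y3 y4
        decide
      set S := Submodule.span (ZMod 2) {a} ⊔ Submodule.span (ZMod 2) {b} ⊔
        Submodule.span (ZMod 2) {u} ⊔ Submodule.span (ZMod 2) {c}
      have mc : c ∈ S := le_sup_right (a := Submodule.span (ZMod 2) {a} ⊔
        Submodule.span (ZMod 2) {b} ⊔ Submodule.span (ZMod 2) {u})
        (Submodule.mem_span_singleton_self c)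
      have mu : u ∈ S := (le_sup_right.trans le_sup_left : Submodule.span (ZMod 2) {u} ≤ S)
        (Submodule.mem_span_singleton_self u)
      have mb : b ∈ S := ((le_sup_right.trans le_sup_left).trans le_sup_left :
        Submodule.span (ZMod 2) {b} ≤ S) (Submodule.mem_span_singleton_self b)
      have ma : a ∈ S := ((le_sup_left.trans le_sup_left).trans le_sup_left :
        Submodule.span (ZMod 2) {a} ≤ S) (Submodule.mem_span_singleton_self a)
      rw [Fintype.linearCombination_apply, Fin.sum_univ_five, hy0]
      have e : (y 1 + y 2 + y 3 + y 4) • (a * b) + y 1 • (a + a * b) + y 2 • (b + a * b) +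
          y 3 • (u * c) + y 4 • (c + u * c) = y 1 • (a + (a * b + a * b)) +
          y 2 • (b + (a * b + a * b)) + y 3 • (u * c + a * b) + y 4 • (c + (u * c + a * b)) := by
        simp only [add_smul, smul_add]
        abel
      have e' : (y 1 + y 2 + y 3 + y 4) • (a * b) + y 1 • (a + a * b) + y 2 • (b + a * b) +
          y 3 • (u * c) + y 4 • (c + u * c) ∈ S := by
        rw [e, add_self_word, huc', add_zero, add_zero]
        exact S.add_mem (S.add_mem (S.add_mem (S.smul_mem _ ma) (S.smul_mem _ mb))
          (S.smul_mem _ (S.add_mem (S.add_mem mu ma) mb)))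
          (S.smul_mem _ (S.add_mem mc (S.add_mem (S.add_mem mu ma) mb)))
      exact e'

/-- A nonzero `w` in `A` and its complement `w + u` both have weight 8 and split `u`, so `u` meets
`c` in 0, 4 or 8 positions. Size 0 contradicts that `c` meets the code; size 8 puts `c` inside `u`,
where it enlarges `A`; size 4 leads to five disjoint words of weight 4. -/
theorem IsReedMullerLike.isBlockLike_sup_span {B : BinCode ι} (hB : B.IsReedMullerLike)
    {c : ι → ZMod 2} (hcB : c ∉ B) (hc : hammingNorm c = 8)
    (hmeet : ∃ w ∈ B, w * c ≠ 0)
    (hC : (B ⊔ Submodule.span (ZMod 2) {c}).IsTriplyEven) :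
    (B ⊔ Submodule.span (ZMod 2) {c}).IsBlockLike := by
  obtain ⟨A, u, hA, hA2, hu, hAu, rfl⟩ := hB
  set B := A ⊔ Submodule.span (ZMod 2) {u} with hBdef
  have hcm : c ∈ B ⊔ Submodule.span (ZMod 2) {c} :=
    mem_sup_span_singleton.2 ⟨0, B.zero_mem, Or.inr (zero_add c).symm⟩
  have hBC : B ≤ B ⊔ Submodule.span (ZMod 2) {c} := le_sup_left
  have hAB : A ≤ B := le_sup_left
  have huB : u ∈ B := mem_sup_span_singleton.2 ⟨0, A.zero_mem, Or.inr (zero_add u).symm⟩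
  have hBu : ∀ w ∈ B, w * u = w := by
    intro w hw
    obtain ⟨b, hb, rfl | rfl⟩ := mem_sup_span_singleton.1 hw
    · exact hAu _ hb
    · rw [add_mul, hAu b hb, mul_self_word]
  have hu0 : u ≠ 0 := by
    rintro rfl
    simp at hu
  have huA : u ∉ A := by
    intro h
    have := hA u h hu0
    omega
  have h8 : ∀ w ∈ A, w ≠ 0 → hammingNorm (w + u) = 8 := by
    intro w hw hw0
    have := hammingNorm_add_add w u
    rw [hAu w hw, hA w hw hw0] at this
    omega
  have hf : ∀ w ∈ A, w ≠ 0 → (hammingNorm (w * c) = 0 ∨ hammingNorm (w * c) = 4) := by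
    intro w hw hw0
    exact hC.hammingNorm_mul (hBC (hAB hw)) hcm (hA w hw hw0) hc (fun h => hcB (h ▸ hAB hw))
  have hf' : ∀ w ∈ A, w ≠ 0 →
      (hammingNorm ((w + u) * c) = 0 ∨ hammingNorm ((w + u) * c) = 4) := by
    intro w hw hw0
    have hm : w + u ∈ B := B.add_mem (hAB hw) huB
    exact hC.hammingNorm_mul (hBC hm) hcm (h8 w hw hw0) hc (fun h => hcB (h ▸ hm))
  have hsum : ∀ w ∈ A, hammingNorm (w * c) + hammingNorm ((w + u) * c) = hammingNorm (u * c) := by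
    intro w hw
    have e1 : (w * c) * ((w + u) * c) = 0 := by
      have : (w * c) * ((w + u) * c) = (w * w) * (c * c) + (w * u) * (c * c) := by ring
      rw [this, mul_self_word, hAu w hw, add_self_word]
    rw [← hammingNorm_add_of_mul_eq_zero e1]
    have : w * c + (w + u) * c = (w + w) * c + u * c := by ring
    rw [this, add_self_word, zero_mul, zero_add]
  have hAbot : A ≠ ⊥ := by
    intro h
    rw [h, finrank_bot] at hA2
    omega
  obtain ⟨w₀, hw₀, hw₀0⟩ := A.ne_bot_iff.1 hAbot
  have hcases : hammingNorm (u * c) = 0 ∨ hammingNorm (u * c) = 4 ∨ hammingNorm (u * c) = 8 := by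
    have h1 := hf w₀ hw₀ hw₀0
    have h2 := hf' w₀ hw₀ hw₀0
    have h3 := hsum w₀ hw₀
    omega
  rcases hcases with h0 | h4 | h8c
  · obtain ⟨w, hw, hwc⟩ := hmeet
    rw [hammingNorm_eq_zero] at h0
    rw [← hBu w hw, mul_assoc, h0, mul_zero] at hwc
    exact absurd rfl hwc
  · right; right
    have hor : ∀ w ∈ A, w * c = 0 ∨ (w + u) * c = 0 := by
      intro w hw
      by_cases hw0 : w = 0
      · left
        rw [hw0, zero_mul]
      rw [← hammingNorm_eq_zero (x := w * c), ← hammingNorm_eq_zero (x := (w + u) * c)]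
      have h1 := hf w hw hw0
      have h2 := hf' w hw hw0
      have h3 := hsum w hw
      omega
    have huc0 : u * c ≠ 0 := by
      rw [← hammingNorm_ne_zero_iff]
      omega
    -- One word of each complementary pair avoids `c`, and these words form another complement of
    -- `u` in `B`. Replacing `A` by `Z` makes the equidistant part disjoint from `c`.
    set Z : BinCode ι := B ⊓ LinearMap.ker (LinearMap.mulRight (ZMod 2) c) with hZdef
    have memZ : ∀ {w}, w ∈ Z ↔ w ∈ B ∧ w * c = 0 := by
      intro w
      rw [hZdef, Submodule.mem_inf, LinearMap.mem_ker, LinearMap.mulRight_apply]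
    have huZ : u ∉ Z := fun h => huc0 (memZ.1 h).2
    have hZu : B = Z ⊔ Submodule.span (ZMod 2) {u} := by
      apply le_antisymm
      · rw [hBdef, sup_le_iff]
        refine ⟨fun w hw => ?_, le_sup_right⟩
        rw [mem_sup_span_singleton]
        rcases hor w hw with h | h
        · exact ⟨w, memZ.2 ⟨hAB hw, h⟩, Or.inl rfl⟩
        · refine ⟨w + u, memZ.2 ⟨B.add_mem (hAB hw) huB, h⟩, Or.inr ?_⟩
          rw [add_assoc, add_self_word, add_zero]
      · rw [sup_le_iff, Submodule.span_singleton_le_iff_mem]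
        exact ⟨inf_le_left, huB⟩
    have hZrank : Module.finrank (ZMod 2) Z = Module.finrank (ZMod 2) A := by
      have h1 := finrank_sup_span huA
      have h2 := finrank_sup_span huZ
      rw [← hZu] at h2
      rw [← hBdef] at h1
      omega
    have hZ : Z.IsEquidistant := by
      intro w hw hw0
      obtain ⟨hwB, hwc⟩ := memZ.1 hw
      obtain ⟨b, hb, rfl | rfl⟩ := mem_sup_span_singleton.1 hwB
      · exact hA _ hb hw0
      · apply h8 b hb
        rintro rfl
        rw [zero_add] at hwc
        exact huc0 hwc
    -- The codewords of `Z` avoid the 4 positions `u * c` of `u`, which leaves room for dimension 2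
    -- only.
    have hZ2 : Module.finrank (ZMod 2) Z = 2 := by
      refine hZ.finrank_eq_two (hZrank ▸ hA2) hu h4 ?_ (fun w hw => hBu w (memZ.1 hw).1) ?_
      · rw [mul_comm u c, mul_assoc, mul_self_word]
      · intro w hw
        rw [mul_left_comm, (memZ.1 hw).2, mul_zero]
    obtain ⟨a, b, ha0, hb0, hab, hZab⟩ := exists_basis_of_finrank_eq_two hZ2
    have haZ : a ∈ Z := hZab ▸ (le_sup_left : _ ≤ Submodule.span (ZMod 2) {a} ⊔
      Submodule.span (ZMod 2) {b}) (Submodule.mem_span_singleton_self a)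
    have hbZ : b ∈ Z := hZab ▸ (le_sup_right : _ ≤ Submodule.span (ZMod 2) {a} ⊔
      Submodule.span (ZMod 2) {b}) (Submodule.mem_span_singleton_self b)
    rw [hZu, hZab]
    exact isParityLike_of_four (hZ a haZ ha0) (hZ b hbZ hb0)
      (hZ _ (Z.add_mem haZ hbZ) fun h => hab (add_eq_zero_word.1 h)) hu hc
      (hBu a (memZ.1 haZ).1) (hBu b (memZ.1 hbZ).1) (memZ.1 haZ).2 (memZ.1 hbZ).2 h4
  · right; left
    have hcA : c ∉ A := fun h => hcB (hAB h)
    have hcu : c * u = c := by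
      apply mul_eq_self_of_hammingNorm
      rw [mul_comm, h8c, hc]
    refine ⟨A ⊔ Submodule.span (ZMod 2) {c}, u, hA.sup_span hc ?_, ?_, hu, ?_, ?_⟩
    · intro w hw hw0
      have h1 := hf w hw hw0
      have h2 := hf' w hw hw0
      have h3 := hsum w hw
      omega
    · rw [finrank_sup_span hcA]
      omega
    · intro w hw
      obtain ⟨b, hb, rfl | rfl⟩ := mem_sup_span_singleton.1 hw
      · exact hAu _ hb
      · rw [add_mul, hAu b hb, hcu]
    · rw [hBdef, sup_right_comm]

theorem hammingNorm_sum {σ : Type} (s : Finset σ) (g : σ → ι → ZMod 2)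
    (hg : ∀ i j, i ≠ j → g i * g j = 0) :
    hammingNorm (∑ i ∈ s, g i) = ∑ i ∈ s, hammingNorm (g i) := by
  classical
  induction s using Finset.induction_on with
  | empty => simp
  | insert a s ha ih =>
    rw [Finset.sum_insert ha, Finset.sum_insert ha, ← ih, hammingNorm_add_of_mul_eq_zero]
    rw [Finset.mul_sum]
    exact Finset.sum_eq_zero fun j hj => hg a j fun h => ha (h ▸ hj)

/-- Any two pieces together meet `c` in 0 or 4 positions. With at least five pieces this forces `c`
to contain exactly one piece and avoid the others; the rest of `c` is then a new piece of weight 4.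
-/
theorem IsParityLike.isParityLike_sup_span {B : BinCode ι} (hB : B.IsParityLike)
    {c : ι → ZMod 2} (hcB : c ∉ B) (hc : hammingNorm c = 8)
    (hmeet : ∃ w ∈ B, w * c ≠ 0)
    (hC : (B ⊔ Submodule.span (ZMod 2) {c}).IsTriplyEven) :
    (B ⊔ Submodule.span (ZMod 2) {c}).IsParityLike := by
  obtain ⟨k, hk, h, h4, hd, rfl⟩ := hB
  set B := (parityCheck k).map (Fintype.linearCombination (ZMod 2) h) with hBdef
  have hcm : c ∈ B ⊔ Submodule.span (ZMod 2) {c} :=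
    mem_sup_span_singleton.2 ⟨0, B.zero_mem, Or.inr (zero_add c).symm⟩
  have hBC : B ≤ B ⊔ Submodule.span (ZMod 2) {c} := le_sup_left
  have hpair : ∀ i j, h i + h j ∈ B := by
    intro i j
    refine ⟨Pi.single i 1 + Pi.single j 1, ?_, ?_⟩
    · change ∑ l, (Pi.single i 1 + Pi.single j 1 : Fin (k + 1) → ZMod 2) l = 0
      simp [Finset.sum_add_distrib, CharTwo.add_self_eq_zero]
    · rw [map_add, Fintype.linearCombination_apply_single, Fintype.linearCombination_apply_single,
        one_smul, one_smul]
  have hx : ∀ i j, i ≠ j → (hammingNorm (h i * c) + hammingNorm (h j * c) = 0 ∨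
      hammingNorm (h i * c) + hammingNorm (h j * c) = 4) := by
    intro i j hij
    have e : (h i * c) * (h j * c) = 0 := by
      rw [mul_mul_mul_comm, hd i j hij, zero_mul]
    rw [← hammingNorm_add_of_mul_eq_zero e, ← add_mul]
    refine hC.hammingNorm_mul (hBC (hpair i j)) hcm ?_ hc (fun h' => hcB (h' ▸ hpair i j))
    rw [hammingNorm_add_of_mul_eq_zero (hd i j hij), h4, h4]
  obtain ⟨i₀, hi₀⟩ : ∃ i, hammingNorm (h i * c) ≠ 0 := by
    by_contra! hall
    obtain ⟨_, ⟨y, hy, rfl⟩, hwc⟩ := hmeet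
    apply hwc
    rw [Fintype.linearCombination_apply, Finset.sum_mul]
    refine Finset.sum_eq_zero fun i _ => ?_
    rw [smul_mul_assoc, hammingNorm_eq_zero.1 (hall i), smul_zero]
  have hle : ∑ i, hammingNorm (h i * c) ≤ 8 := by
    rw [← hammingNorm_sum _ _ fun i j hij => by rw [mul_mul_mul_comm, hd i j hij, zero_mul],
      ← Finset.sum_mul, mul_comm, ← hc]
    exact hammingNorm_mul_le _ _
  have hi4 : hammingNorm (h i₀ * c) = 4 := by
    by_contra hne
    -- The only alternative is that `c` meets every piece in 2 positions. This needs at least 10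
    -- positions when `k ≥ 4`; with four pieces it could happen, whence the bound in `IsParityLike`.
    have hall : ∀ i, hammingNorm (h i * c) = 2 := by
      have h1 : ∀ j, j ≠ i₀ → hammingNorm (h i₀ * c) + hammingNorm (h j * c) = 4 := by
        intro j hj
        have := hx i₀ j hj.symm
        omega
      have h2 : hammingNorm (h i₀ * c) = 2 := by
        obtain ⟨j, hj⟩ : ∃ j, j ≠ i₀ :=
          Fintype.exists_ne_of_one_lt_card (by rw [Fintype.card_fin]; omega) i₀
        obtain ⟨l, hl⟩ : ∃ l, l ∉ ({i₀, j} : Finset (Fin (k + 1))) := by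
          by_contra! hall
          have h3 := Finset.card_le_card (fun x _ => hall x :
            (Finset.univ : Finset (Fin (k + 1))) ⊆ {i₀, j})
          rw [Finset.card_univ, Fintype.card_fin] at h3
          have := Finset.card_le_two (a := i₀) (b := j)
          omega
        simp only [Finset.mem_insert, Finset.mem_singleton, not_or] at hl
        have e1 := h1 j hj
        have e2 := h1 l hl.1
        have e3 := hx l j hl.2
        omega
      intro i
      by_cases hi : i = i₀
      · rw [hi, h2]
      · have := h1 i hi
        omega
    simp_rw [hall] at hle
    rw [Finset.sum_const, Finset.card_univ, Fintype.card_fin, smul_eq_mul] at hle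
    omega
  have hzero : ∀ j, j ≠ i₀ → h j * c = 0 := by
    intro j hj
    rw [← hammingNorm_eq_zero]
    have := hx i₀ j hj.symm
    omega
  have hcov : h i₀ * c = h i₀ := mul_eq_self_of_hammingNorm (by rw [hi4, h4])
  have hnew : ∀ j, h j * (c + h i₀) = 0 := by
    intro j
    by_cases hj : j = i₀
    · rw [hj, mul_add, hcov, mul_self_word, add_self_word]
    · rw [mul_add, hzero j hj, hd j i₀ hj, zero_add]
  refine ⟨k + 1, by omega, Fin.snoc (α := fun _ => ι → ZMod 2) h (c + h i₀), ?_, ?_, ?_⟩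
  · intro i
    refine Fin.lastCases ?_ (fun i => ?_) i
    · rw [Fin.snoc_last]
      have := hammingNorm_add_add c (h i₀)
      rw [mul_comm c, hi4, hc, h4] at this
      omega
    · rw [Fin.snoc_castSucc, h4]
  · intro i j
    refine Fin.lastCases ?_ (fun i => ?_) i <;> refine Fin.lastCases ?_ (fun j => ?_) j
    · intro hij
      exact absurd rfl hij
    · intro _
      rw [Fin.snoc_last, Fin.snoc_castSucc, mul_comm, hnew]
    · intro _
      rw [Fin.snoc_last, Fin.snoc_castSucc, hnew]
    · intro hij
      rw [Fin.snoc_castSucc, Fin.snoc_castSucc, hd]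
      rintro rfl
      exact hij rfl
  · have hLC : ∀ y : Fin (k + 1 + 1) → ZMod 2,
        Fintype.linearCombination (ZMod 2) (Fin.snoc (α := fun _ => ι → ZMod 2) h (c + h i₀)) y =
          Fintype.linearCombination (ZMod 2) h (fun i => y i.castSucc) +
            y (Fin.last _) • (c + h i₀) := by
      intro y
      rw [Fintype.linearCombination_apply, Fin.sum_univ_castSucc, Fintype.linearCombination_apply]
      simp_rw [Fin.snoc_castSucc, Fin.snoc_last]
    apply le_antisymm
    · rw [sup_le_iff, Submodule.span_singleton_le_iff_mem]
      constructor
      · rintro _ ⟨y, hy, rfl⟩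
        refine ⟨Fin.snoc (α := fun _ => ZMod 2) y 0, ?_, ?_⟩
        · change ∑ i, Fin.snoc (α := fun _ => ZMod 2) y 0 i = 0
          rw [Fin.sum_univ_castSucc]
          simp_rw [Fin.snoc_castSucc, Fin.snoc_last]
          rw [add_zero]
          exact hy
        · rw [hLC, Fin.snoc_last, zero_smul, add_zero]
          simp_rw [Fin.snoc_castSucc]
      · refine ⟨Fin.snoc (α := fun _ => ZMod 2) (Pi.single i₀ 1) 1, ?_, ?_⟩
        · change ∑ i, Fin.snoc (α := fun _ => ZMod 2) (Pi.single i₀ 1) 1 i = 0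
          rw [Fin.sum_univ_castSucc]
          simp_rw [Fin.snoc_castSucc, Fin.snoc_last]
          rw [Finset.sum_pi_single']
          simp [CharTwo.add_self_eq_zero]
        · rw [hLC, Fin.snoc_last, one_smul]
          simp_rw [Fin.snoc_castSucc]
          rw [Fintype.linearCombination_apply_single, one_smul, add_left_comm, add_self_word,
            add_zero]
    · rintro _ ⟨y, hy, rfl⟩
      rw [hLC]
      have hy' : (∑ i : Fin (k + 1), y i.castSucc) + y (Fin.last _) = 0 := by
        have : ∑ i, y i = 0 := hy
        rwa [Fin.sum_univ_castSucc] at this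
      -- The part `h i₀` of the new piece is moved into coordinate `i₀`, which restores even parity
      -- on the old pieces.
      have e : Fintype.linearCombination (ZMod 2) h (fun i => y i.castSucc) +
            y (Fin.last _) • (c + h i₀) = Fintype.linearCombination (ZMod 2) h
              ((fun i => y i.castSucc) + Pi.single i₀ (y (Fin.last _))) + y (Fin.last _) • c := by
        rw [map_add, Fintype.linearCombination_apply_single, smul_add]
        abel
      rw [e]
      refine Submodule.add_mem _ (hBC ⟨_, ?_, rfl⟩) (Submodule.smul_mem _ _ hcm)
      change ∑ i, ((fun i => y i.castSucc) + Pi.single i₀ (y (Fin.last _)) : Fin (k + 1) → ZMod 2) i = 0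
      simp only [Pi.add_apply]
      rw [Finset.sum_add_distrib]
      simpa using hy'

theorem IsBlockLike.isBlockLike_sup_span {B : BinCode ι} (hB : B.IsBlockLike)
    {c : ι → ZMod 2} (hcB : c ∉ B) (hc : hammingNorm c = 8)
    (hmeet : ∃ w ∈ B, w * c ≠ 0)
    (hC : (B ⊔ Submodule.span (ZMod 2) {c}).IsTriplyEven) :
    (B ⊔ Submodule.span (ZMod 2) {c}).IsBlockLike := by
  rcases hB with hB | hB | hB
  · exact hB.1.isBlockLike_sup_span hcB hc hmeet hC
  · exact hB.isBlockLike_sup_span hcB hc hmeet hC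
  · exact Or.inr (Or.inr (hB.isParityLike_sup_span hcB hc hmeet hC))

end Steps

/-! ### Splitting off a maximal block -/

section Splitting

variable {ι : Type} [Fintype ι]

theorem IsTriplyEven.mono {B C : BinCode ι} (hC : C.IsTriplyEven) (h : B ≤ C) :
    B.IsTriplyEven := fun c hc => hC c (h hc)

theorem isEquidistant_span_singleton {c : ι → ZMod 2} (hc : hammingNorm c = 8) :
    IsEquidistant (Submodule.span (ZMod 2) {c}) := by
  intro w hw hw0
  obtain ⟨t, rfl⟩ := Submodule.mem_span_singleton.1 hw
  have ht : t ≠ 0 := by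
    rintro rfl
    exact hw0 (zero_smul _ _)
  rw [eq_one_of_ne_zero ht, one_smul, hc]

/-- In a triply-even code a block-like subcode of maximal dimension meets no codeword of weight `8`
outside of it. -/
theorem exists_block_isolated {C : BinCode ι} (hC : C.IsTriplyEven) {c₀ : ι → ZMod 2}
    (hc₀ : c₀ ∈ C) (hw₀ : hammingNorm c₀ = 8) :
    ∃ B ≤ C, B.IsBlockLike ∧ ∀ c ∈ C, hammingNorm c = 8 → c ∉ B → ∀ w ∈ B, w * c = 0 := by
  let P : ℕ → Prop := fun d => ∃ B ≤ C, B.IsBlockLike ∧ Module.finrank (ZMod 2) B = d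
  have h1 : ∃ d, P d := by
    have hc0 : c₀ ≠ 0 := by
      rintro rfl
      simp at hw₀
    refine ⟨_, Submodule.span (ZMod 2) {c₀}, ?_, Or.inl ⟨isEquidistant_span_singleton hw₀, ?_⟩, rfl⟩
    · rwa [Submodule.span_singleton_le_iff_mem]
    · rwa [Ne, Submodule.span_singleton_eq_bot]
  have h2 : ∀ d, P d → d ≤ Module.finrank (ZMod 2) C := by
    rintro d ⟨B, hB, -, rfl⟩
    exact Submodule.finrank_mono hB
  obtain ⟨d, hd⟩ := h1
  classical
  -- Maximality of the dimension makes sense because the dimension of `C` bounds it.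
  obtain ⟨B, hBC, hB, hBd⟩ := Nat.findGreatest_spec (P := P) (h2 d hd) hd
  refine ⟨B, hBC, hB, fun c hc hc8 hcB => ?_⟩
  by_contra! hmeet
  have hle : B ⊔ Submodule.span (ZMod 2) {c} ≤ C :=
    sup_le hBC ((Submodule.span_singleton_le_iff_mem _ _).2 hc)
  have h3 : P (Module.finrank (ZMod 2) B + 1) :=
    ⟨_, hle, hB.isBlockLike_sup_span hcB hc8 hmeet (hC.mono hle), finrank_sup_span hcB⟩
  have h4 := Nat.le_findGreatest (P := P) (h2 _ h3) h3
  omega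

theorem IsBlockLike.ne_bot {B : BinCode ι} (hB : B.IsBlockLike) : B ≠ ⊥ := by
  rcases hB with hB | ⟨A, u, -, -, hu, -, rfl⟩ | ⟨k, hk, h, h4, hd, rfl⟩
  · exact hB.2
  · intro hbot
    have : u ∈ (⊥ : BinCode ι) :=
      hbot ▸ mem_sup_span_singleton.2 ⟨0, A.zero_mem, Or.inr (zero_add u).symm⟩
    rw [Submodule.mem_bot] at this
    simp [this] at hu
  · intro hbot
    have hne : (0 : Fin (k + 1)) ≠ Fin.last k := by
      intro h
      have := congrArg Fin.val h
      simp at this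
      omega
    have hm : h 0 + h (Fin.last k) ∈
        (parityCheck k).map (Fintype.linearCombination (ZMod 2) h) := by
      refine ⟨Pi.single 0 1 + Pi.single (Fin.last k) 1, ?_, ?_⟩
      · change ∑ l, (Pi.single 0 1 + Pi.single (Fin.last k) 1 : Fin (k + 1) → ZMod 2) l = 0
        simp [Finset.sum_add_distrib, CharTwo.add_self_eq_zero]
      · rw [map_add, Fintype.linearCombination_apply_single,
          Fintype.linearCombination_apply_single, one_smul, one_smul]
    rw [hbot, Submodule.mem_bot] at hm
    have := hammingNorm_add_of_mul_eq_zero (hd _ _ hne)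
    rw [hm, h4, h4, hammingNorm_zero] at this
    omega

/-- The complement `D` is spanned by the codewords of weight 8 outside a maximal block `B`, all
disjoint from `B`. It is smaller than `C`, since a nonzero word of `B` lying in `D` would be
disjoint from itself. -/
theorem exists_splitting {C : BinCode ι} (hC : C.IsTriplyEven) (hspan : C.IsSpannedByWeight 8)
    (hbot : C ≠ ⊥) :
    ∃ B D : BinCode ι, B.IsBlockLike ∧ D.IsTriplyEven ∧ D.IsSpannedByWeight 8 ∧ C = B ⊔ D ∧
      (∀ w ∈ B, ∀ x ∈ D, w * x = 0) ∧
      Module.finrank (ZMod 2) D < Module.finrank (ZMod 2) C := by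
  obtain ⟨c₀, hc₀, hw₀⟩ : ∃ c ∈ C, hammingNorm c = 8 := by
    by_contra! hall
    apply hbot
    rw [← hspan, Submodule.span_eq_bot]
    rintro c ⟨hc, hc8⟩
    exact absurd hc8 (hall c hc)
  obtain ⟨B, hBC, hB, hiso⟩ := exists_block_isolated hC hc₀ hw₀
  set S : Set (ι → ZMod 2) := {c | (c ∈ C ∧ hammingNorm c = 8) ∧ c ∉ B}
  have hSC : Submodule.span (ZMod 2) S ≤ C := Submodule.span_le.2 fun c hc => hc.1.1
  have hdisj : ∀ w ∈ B, ∀ x ∈ Submodule.span (ZMod 2) S, w * x = 0 := by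
    intro w hw x hx
    have : Submodule.span (ZMod 2) S ≤ LinearMap.ker (LinearMap.mulLeft (ZMod 2) w) := by
      rw [Submodule.span_le]
      intro c hc
      exact hiso c hc.1.1 hc.1.2 hc.2 w hw
    exact this hx
  refine ⟨B, Submodule.span (ZMod 2) S, hB, hC.mono hSC, ?_, ?_, hdisj, ?_⟩
  · apply le_antisymm
    · rw [Submodule.span_le]
      exact fun c hc => hc.1
    · exact Submodule.span_mono fun c hc => ⟨Submodule.subset_span hc, hc.1.2⟩
  · apply le_antisymm
    · conv_lhs => rw [← hspan]
      rw [Submodule.span_le]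
      intro c hc
      by_cases hcB : c ∈ B
      · exact (le_sup_left : B ≤ _) hcB
      · exact (le_sup_right : _ ≤ B ⊔ Submodule.span (ZMod 2) S)
          (Submodule.subset_span ⟨hc, hcB⟩)
    · exact sup_le hBC hSC
  · apply Submodule.finrank_lt_finrank_of_lt
    refine lt_of_le_of_ne hSC fun h => ?_
    obtain ⟨w, hw, hw0⟩ := B.ne_bot_iff.1 hB.ne_bot
    have := hdisj w hw w (h ▸ hBC hw)
    rw [mul_self_word] at this
    exact hw0 this

end Splitting

/-! ### Weight-controlled parametrizations of the listed codes -/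

section Parametrizations

variable {ι : Type}

theorem range_linearCombination_eq_ofMatrix {ρ : Type} [Fintype ρ] (G : Matrix ρ ι (ZMod 2)) :
    LinearMap.range (Fintype.linearCombination (ZMod 2) fun r i => G r i) = ofMatrix G :=
  Fintype.range_linearCombination _ _

theorem range_funLeft_comp {Y : Type} [AddCommGroup Y] [Module (ZMod 2) Y] (m : ℕ)
    (Ψ : Y →ₗ[ZMod 2] ι → ZMod 2) :
    LinearMap.range (LinearMap.funLeft (ZMod 2) (ZMod 2) (Prod.snd : Fin m × ι → ι) ∘ₗ Ψ) =
      repetition m (LinearMap.range Ψ) :=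
  LinearMap.range_comp _ _

theorem hammingNorm_funLeft_snd [Fintype ι] (m : ℕ) (x : ι → ZMod 2) :
    hammingNorm (LinearMap.funLeft (ZMod 2) (ZMod 2) (Prod.snd : Fin m × ι → ι) x) =
      m * hammingNorm x := by
  rw [hammingNorm_eq_sum_val, hammingNorm_eq_sum_val, Fintype.sum_prod_type]
  simp [LinearMap.funLeft_apply]

theorem two_mul_sum_add_val {Y : Type} [AddCommGroup Y] [Module (ZMod 2) Y] [Fintype Y]
    {l : Y →ₗ[ZMod 2] ZMod 2} (hl : l ≠ 0) (t : ZMod 2) :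
    2 * ∑ y, (t + l y).val = Fintype.card Y := by
  have : (2 : ℤ) * ∑ y, ((t + l y).val : ℤ) = Fintype.card Y := by
    simp_rw [Finset.mul_sum, two_mul_val, sgn_add, Finset.sum_sub_distrib, ← Finset.mul_sum,
      sum_sgn_eq_zero hl]
    simp
  exact_mod_cast this

/-- The functional with given coefficients. -/
def dotFunctional {k : ℕ} (y : Fin k → ZMod 2) : (Fin k → ZMod 2) →ₗ[ZMod 2] ZMod 2 :=
  Fintype.linearCombination (ZMod 2) y

theorem dotFunctional_apply {k : ℕ} (y v : Fin k → ZMod 2) :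
    dotFunctional y v = ∑ r, y r * v r := by
  rw [dotFunctional, Fintype.linearCombination_apply]
  exact Finset.sum_congr rfl fun r _ => mul_comm _ _

theorem dotFunctional_comm {k : ℕ} (y v : Fin k → ZMod 2) :
    dotFunctional y v = dotFunctional v y := by
  simp_rw [dotFunctional_apply, mul_comm]

theorem dotFunctional_single {k : ℕ} (r : Fin k) (v : Fin k → ZMod 2) :
    dotFunctional (Pi.single r 1) v = v r := by
  rw [dotFunctional_comm, dotFunctional, Fintype.linearCombination_apply_single, one_smul]

theorem dotFunctional_add {k : ℕ} (x y v : Fin k → ZMod 2) :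
    dotFunctional (x + y) v = dotFunctional x v + dotFunctional y v := by
  rw [dotFunctional_comm, map_add, dotFunctional_comm x, dotFunctional_comm y]

theorem dotFunctional_ne_zero {k : ℕ} {y : Fin k → ZMod 2} (hy : y ≠ 0) : dotFunctional y ≠ 0 := by
  intro h
  apply hy
  ext r
  have := LinearMap.congr_fun h (Pi.single r 1)
  rwa [dotFunctional_comm, dotFunctional_single] at this

/-- The parametrization of the simplex code by coefficient vectors. -/
def simplexMap (k : ℕ) :
    (Fin k → ZMod 2) →ₗ[ZMod 2] {v : Fin k → ZMod 2 // v ≠ 0} → ZMod 2 :=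
  Fintype.linearCombination (ZMod 2) fun r v => v.1 r

theorem simplexMap_apply {k : ℕ} (y : Fin k → ZMod 2) (v : {v : Fin k → ZMod 2 // v ≠ 0}) :
    simplexMap k y v = dotFunctional y v.1 := by
  rw [simplexMap, Fintype.linearCombination_apply, dotFunctional_apply, Finset.sum_apply]
  rfl

theorem range_simplexMap (k : ℕ) : LinearMap.range (simplexMap k) = simplex k :=
  range_linearCombination_eq_ofMatrix _

theorem hammingNorm_simplexMap {k : ℕ} {y : Fin k → ZMod 2} (hy : y ≠ 0) :
    2 * hammingNorm (simplexMap k y) = 2 ^ k := by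
  have h1 := two_mul_sum_val (dotFunctional_ne_zero hy)
  have h2 : Fintype.card (Fin k → ZMod 2) = 2 ^ k := by simp
  rw [h2] at h1
  rw [← h1, hammingNorm_eq_sum_val]
  congr 1
  simp_rw [simplexMap_apply]
  have h3 := Fintype.sum_subtype_add_sum_subtype (fun v : Fin k → ZMod 2 => v ≠ 0)
    fun v => (dotFunctional y v).val
  rw [← h3, left_eq_add]
  refine Finset.sum_eq_zero fun v _ => ?_
  rw [not_not.1 v.2, map_zero, ZMod.val_zero]

/-- Take a coordinate where `v` is nonzero and one where `w` is; if neither coordinate works for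
both vectors, their sum does. -/
theorem exists_simplexMap_eq_one {k : ℕ} (v w : {v : Fin k → ZMod 2 // v ≠ 0}) :
    ∃ y ≠ 0, simplexMap k y v ≠ 0 ∧ simplexMap k y w ≠ 0 := by
  suffices h : ∃ y, simplexMap k y v ≠ 0 ∧ simplexMap k y w ≠ 0 by
    obtain ⟨y, h1, h2⟩ := h
    refine ⟨y, ?_, h1, h2⟩
    rintro rfl
    simp at h1
  simp_rw [simplexMap_apply]
  obtain ⟨r, hr⟩ := Function.ne_iff.1 v.2
  obtain ⟨s, hs⟩ := Function.ne_iff.1 w.2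
  rw [Pi.zero_apply] at hr hs
  by_cases hr' : w.1 r = 0
  · by_cases hs' : v.1 s = 0
    · refine ⟨Pi.single r 1 + Pi.single s 1, ?_, ?_⟩ <;>
        rw [dotFunctional_add, dotFunctional_single, dotFunctional_single]
      · rwa [hs', add_zero]
      · rwa [hr', zero_add]
    · exact ⟨Pi.single s 1, by rwa [dotFunctional_single], by rwa [dotFunctional_single]⟩
  · exact ⟨Pi.single r 1, by rwa [dotFunctional_single], by rwa [dotFunctional_single]⟩

/-- The parametrization of the first order Reed-Muller code by a constant and a coefficient
vector. -/
def reedMullerMap (k : ℕ) :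
    ZMod 2 × (Fin k → ZMod 2) →ₗ[ZMod 2] (Fin k → ZMod 2) → ZMod 2 :=
  (LinearMap.toSpanSingleton (ZMod 2) _ 1).coprod
    (Fintype.linearCombination (ZMod 2) fun r v => v r)

theorem reedMullerMap_apply {k : ℕ} (t : ZMod 2) (y v : Fin k → ZMod 2) :
    reedMullerMap k (t, y) v = t + dotFunctional y v := by
  rw [reedMullerMap, LinearMap.coprod_apply, LinearMap.toSpanSingleton_apply,
    Fintype.linearCombination_apply, dotFunctional_apply, Pi.add_apply, Finset.sum_apply]
  simp

theorem range_reedMullerMap (k : ℕ) :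
    LinearMap.range (reedMullerMap k) = reedMuller (k + 1) := by
  rw [reedMullerMap, LinearMap.range_coprod, LinearMap.range_toSpanSingleton,
    Fintype.range_linearCombination, reedMuller, ofMatrix, Option.range_eq,
    Submodule.span_insert]
  rfl

theorem hammingNorm_reedMullerMap {k : ℕ} (t : ZMod 2) {y : Fin k → ZMod 2} (hy : y ≠ 0) :
    2 * hammingNorm (reedMullerMap k (t, y)) = 2 ^ k := by
  rw [hammingNorm_eq_sum_val]
  simp_rw [reedMullerMap_apply]
  rw [two_mul_sum_add_val (dotFunctional_ne_zero hy)]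
  simp

theorem hammingNorm_reedMullerMap_one (k : ℕ) :
    hammingNorm (reedMullerMap k (1, 0)) = 2 ^ k := by
  rw [hammingNorm_eq_sum_val]
  simp_rw [reedMullerMap_apply, dotFunctional_comm 0, map_zero, add_zero]
  simp [ZMod.val_one]

theorem exists_reedMullerMap_eq_one {k : ℕ} (hk : 2 ≤ k) (v w : Fin k → ZMod 2) :
    ∃ (t : ZMod 2) (y : Fin k → ZMod 2), y ≠ 0 ∧ reedMullerMap k (t, y) v ≠ 0 ∧
      reedMullerMap k (t, y) w ≠ 0 := by
  simp_rw [reedMullerMap_apply]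
  -- Once a nonzero linear form agrees on `v` and `w`, the constant term makes the common value 1.
  suffices h : ∃ y : Fin k → ZMod 2, y ≠ 0 ∧ dotFunctional y v = dotFunctional y w by
    obtain ⟨y, hy, h⟩ := h
    refine ⟨1 + dotFunctional y v, y, hy, ?_, ?_⟩
    · rw [add_assoc, CharTwo.add_self_eq_zero, add_zero]
      exact one_ne_zero
    · rw [h, add_assoc, CharTwo.add_self_eq_zero, add_zero]
      exact one_ne_zero
  by_cases h : ∃ r, v r = w r
  · obtain ⟨r, hr⟩ := h
    refine ⟨Pi.single r 1, ?_, by rw [dotFunctional_single, dotFunctional_single, hr]⟩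
    intro h0
    simpa using congrFun h0 r
  · push Not at h
    -- If `v` and `w` differ in every coordinate, the sum of two coordinates agrees on them; this is
    -- where `2 ≤ k` enters.
    have key : ∀ a b c d : ZMod 2, a ≠ c → b ≠ d → a + b = c + d := by decide
    refine ⟨Pi.single ⟨0, by omega⟩ 1 + Pi.single ⟨1, by omega⟩ 1, ?_, ?_⟩
    · intro h0
      have h1 := congrFun h0 ⟨0, by omega⟩
      rw [Pi.add_apply, Pi.single_eq_same, Pi.single_eq_of_ne (by simp)] at h1
      simp at h1
    · simp_rw [dotFunctional_add, dotFunctional_single]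
      exact key _ _ _ _ (h _) (h _)

/-- The parametrization of the parity check code by the last coordinates. -/
def parityMap (k : ℕ) : (Fin k → ZMod 2) →ₗ[ZMod 2] Fin (k + 1) → ZMod 2 where
  toFun y := Fin.cons (∑ i, y i) y
  map_add' x y := by
    ext i
    refine Fin.cases ?_ (fun i => ?_) i
    · simp [Finset.sum_add_distrib]
    · simp
  map_smul' t y := by
    ext i
    refine Fin.cases ?_ (fun i => ?_) i
    · simp [Finset.mul_sum]
    · simp

theorem range_parityMap (k : ℕ) : LinearMap.range (parityMap k) = parityCheck k := by
  ext c
  rw [LinearMap.mem_range, mem_parityCheck, Fin.sum_univ_succ]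
  constructor
  · rintro ⟨y, rfl⟩
    simp [parityMap, CharTwo.add_self_eq_zero]
  · intro h
    refine ⟨fun i => c i.succ, ?_⟩
    rw [CharTwo.add_eq_zero] at h
    ext i
    refine Fin.cases ?_ (fun i => ?_) i
    · simp [parityMap, h]
    · simp [parityMap]

/-- The parametrization of the parity check code of length `4` as a first order Reed-Muller
code. -/
def parityThreeMap : ZMod 2 × (Fin 2 → ZMod 2) →ₗ[ZMod 2] Fin 4 → ZMod 2 :=
  (LinearMap.toSpanSingleton (ZMod 2) _ 1).coprod
    (Fintype.linearCombination (ZMod 2) ![![1, 1, 0, 0], ![1, 0, 1, 0]])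

theorem parityThreeMap_apply (x : ZMod 2 × (Fin 2 → ZMod 2)) :
    parityThreeMap x = ![x.1 + x.2 0 + x.2 1, x.1 + x.2 0, x.1 + x.2 1, x.1] := by
  rw [parityThreeMap, LinearMap.coprod_apply, LinearMap.toSpanSingleton_apply,
    Fintype.linearCombination_apply, Fin.sum_univ_two]
  ext i
  fin_cases i <;> simp [add_assoc]

theorem range_parityThreeMap : LinearMap.range parityThreeMap = parityCheck 3 := by
  ext c
  rw [LinearMap.mem_range, mem_parityCheck, Fin.sum_univ_four]
  simp_rw [parityThreeMap_apply]
  constructor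
  · rintro ⟨⟨t, y⟩, rfl⟩
    simp only [Matrix.cons_val]
    generalize y 0 = a
    generalize y 1 = b
    revert t a b
    decide
  · intro h
    refine ⟨(c 3, ![c 1 + c 3, c 2 + c 3]), ?_⟩
    have key : ∀ p q r s : ZMod 2, p + q + r + s = 0 →
        ![s + (q + s) + (r + s), s + (q + s), s + (r + s), s] = ![p, q, r, s] := by decide
    have := key _ _ _ _ h
    rw [show c = ![c 0, c 1, c 2, c 3] by ext i; fin_cases i <;> rfl]
    simpa using this

end Parametrizations

end BinCode

/-! ### Identifying block-like codes with building blocks -/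

instance TriplyEvenBlock.instFintypePos : (t : TriplyEvenBlock) → Fintype t.Pos
  | .twiceSimplexThree => inferInstanceAs (Fintype (Fin 2 × {v : Fin 3 → ZMod 2 // v ≠ 0}))
  | .simplexFour => inferInstanceAs (Fintype {v : Fin 4 → ZMod 2 // v ≠ 0})
  | .twiceReedMullerFour => inferInstanceAs (Fintype (Fin 2 × (Fin (4 - 1) → ZMod 2)))
  | .reedMullerFive => inferInstanceAs (Fintype (Fin (5 - 1) → ZMod 2))
  | .fourTimesParity k _ => inferInstanceAs (Fintype (Fin 4 × Fin (k + 1)))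

namespace BinCode

section Blocks

/-- Any two positions of a building block lie in the support of a codeword of weight `8`. -/
theorem exists_codeword_weight_eight (t : TriplyEvenBlock) (p q : t.Pos) :
    ∃ c ∈ t.code, hammingNorm c = 8 ∧ c p ≠ 0 ∧ c q ≠ 0 := by
  cases t with
  | twiceSimplexThree =>
    obtain ⟨y, hy, h1, h2⟩ := exists_simplexMap_eq_one (k := 3) p.2 q.2
    refine ⟨_, (range_simplexMap 3 ▸ range_funLeft_comp 2 (simplexMap 3)).le ⟨y, rfl⟩, ?_, h1, h2⟩
    have := hammingNorm_simplexMap hy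
    refine (hammingNorm_funLeft_snd 2 (simplexMap 3 y)).trans ?_
    omega
  | simplexFour =>
    obtain ⟨y, hy, h1, h2⟩ := exists_simplexMap_eq_one (k := 4) p q
    refine ⟨_, (range_simplexMap 4).le ⟨y, rfl⟩, ?_, h1, h2⟩
    have := hammingNorm_simplexMap hy
    change hammingNorm (simplexMap 4 y) = 8
    omega
  | twiceReedMullerFour =>
    obtain ⟨t, y, hy, h1, h2⟩ := exists_reedMullerMap_eq_one (k := 3) (by norm_num) p.2 q.2
    refine ⟨_, (range_reedMullerMap 3 ▸ range_funLeft_comp 2 (reedMullerMap 3)).le ⟨(t, y), rfl⟩,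
      ?_, h1, h2⟩
    have := hammingNorm_reedMullerMap t hy
    refine (hammingNorm_funLeft_snd 2 (reedMullerMap 3 (t, y))).trans ?_
    omega
  | reedMullerFive =>
    obtain ⟨t, y, hy, h1, h2⟩ := exists_reedMullerMap_eq_one (k := 4) (by norm_num) p q
    refine ⟨_, (range_reedMullerMap 4).le ⟨(t, y), rfl⟩, ?_, h1, h2⟩
    have := hammingNorm_reedMullerMap t hy
    change hammingNorm (reedMullerMap 4 (t, y)) = 8
    omega
  | fourTimesParity k hk =>
    obtain ⟨p', p⟩ := p
    obtain ⟨q', q⟩ := q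
    suffices h : ∃ c ∈ parityCheck k, hammingNorm c = 2 ∧ c p ≠ 0 ∧ c q ≠ 0 by
      obtain ⟨c, hc, hc2, h1, h2⟩ := h
      refine ⟨_, ⟨c, hc, rfl⟩, ?_, h1, h2⟩
      refine (hammingNorm_funLeft_snd 4 c).trans ?_
      omega
    suffices h : ∀ p q : Fin (k + 1), p ≠ q →
        ∃ c ∈ parityCheck k, hammingNorm c = 2 ∧ c p ≠ 0 ∧ c q ≠ 0 by
      by_cases hpq : p = q
      · obtain ⟨q', hq'⟩ : ∃ q', q' ≠ p :=
          Fintype.exists_ne_of_one_lt_card (by rw [Fintype.card_fin]; omega) p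
        obtain ⟨c, hc, hc2, h1, -⟩ := h p q' hq'.symm
        exact ⟨c, hc, hc2, h1, hpq ▸ h1⟩
      · exact h p q hpq
    intro p q hpq
    refine ⟨Pi.single p 1 + Pi.single q 1, ?_, ?_, ?_, ?_⟩
    · rw [mem_parityCheck]
      simp [Finset.sum_add_distrib, CharTwo.add_self_eq_zero]
    · have h1 : ∀ i : Fin (k + 1), hammingNorm (Pi.single i 1 : Fin (k + 1) → ZMod 2) = 1 := by
        intro i
        rw [hammingNorm_eq_sum_val, Finset.sum_eq_single i]
        · rw [Pi.single_eq_same, ZMod.val_one]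
        · intro j _ hj
          rw [Pi.single_eq_of_ne hj, ZMod.val_zero]
        · simp
      rw [hammingNorm_add_of_mul_eq_zero, h1, h1]
      ext i
      rw [Pi.mul_apply]
      by_cases hi : i = p
      · rw [Pi.single_eq_of_ne (i := q) (hi ▸ hpq), mul_zero, Pi.zero_apply]
      · rw [Pi.single_eq_of_ne hi, zero_mul, Pi.zero_apply]
    · rw [Pi.add_apply, Pi.single_eq_same, Pi.single_eq_of_ne hpq]
      simp
    · rw [Pi.add_apply, Pi.single_eq_same, Pi.single_eq_of_ne hpq.symm]
      simp

variable {ι : Type} [Fintype ι]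

/-- The code `B` is the code of the building block `t`, placed at the positions `e` and extended by
zeros. -/
def IsPlacedAt {ι : Type} (B : BinCode ι) (t : TriplyEvenBlock) (e : t.Pos → ι) : Prop :=
  Function.Injective e ∧
    ∀ x, x ∈ B ↔ (fun p => x (e p)) ∈ t.code ∧ ∀ i ∉ Set.range e, x i = 0

/-- The extension theorem applies because every position of a building block lies in the support of
some codeword. -/
theorem exists_isPlacedAt {B : BinCode ι} (t : TriplyEvenBlock) {Y : Type} [AddCommGroup Y]
    [Module (ZMod 2) Y] [Finite Y] (Φ : Y →ₗ[ZMod 2] ι → ZMod 2) (hΦ : LinearMap.range Φ = B)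
    (Ψ : Y →ₗ[ZMod 2] t.Pos → ZMod 2) (hΨ : LinearMap.range Ψ = t.code)
    (hw : ∀ y, hammingNorm (Φ y) = hammingNorm (Ψ y)) : ∃ t e, B.IsPlacedAt t e := by
  have : Fintype Y := Fintype.ofFinite Y
  obtain ⟨e, he, h1, h2⟩ := exists_embedding Φ Ψ hw (by
    intro p
    obtain ⟨c, hc, -, hcp, -⟩ := exists_codeword_weight_eight t p p
    rw [← hΨ] at hc
    obtain ⟨y, rfl⟩ := hc
    exact ⟨y, hcp⟩)
  refine ⟨t, e, he, fun x => ?_⟩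
  rw [← hΦ, ← hΨ]
  constructor
  · rintro ⟨y, rfl⟩
    exact ⟨⟨y, funext fun p => (h1 y p).symm⟩, h2 y⟩
  · rintro ⟨⟨y, hy⟩, hx⟩
    refine ⟨y, funext fun i => ?_⟩
    by_cases hi : i ∈ Set.range e
    · obtain ⟨p, rfl⟩ := hi
      rw [h1, hy]
    · rw [h2 y i hi, hx i hi]

theorem IsEquidistant.finrank_le {B : BinCode ι} (hB : B.IsEquidistant) :
    Module.finrank (ZMod 2) B ≤ 4 := by
  have h1 := hB.effectiveLength_mul
  have h2 : Nat.card B ∣ 16 := by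
    rw [← Nat.dvd_add_right (Dvd.intro_left _ rfl : Nat.card B ∣ B.effectiveLength * Nat.card B),
      h1]
    exact Dvd.intro_left _ rfl
  rw [card_eq_two_pow, show 16 = 2 ^ 4 by norm_num] at h2
  exact (Nat.pow_dvd_pow_iff_le_right (by norm_num)).1 h2

/-- Between equidistant codes of equal dimension every linear isomorphism preserves weights, so an
arbitrary one serves. -/
theorem IsEquidistant.exists_isPlacedAt {B : BinCode ι} (hB : B.IsEquidistant)
    (t : TriplyEvenBlock) {k : ℕ} (hk : Module.finrank (ZMod 2) B = k)
    (Ψ : (Fin k → ZMod 2) →ₗ[ZMod 2] t.Pos → ZMod 2) (hΨ : LinearMap.range Ψ = t.code)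
    (hw : ∀ y ≠ 0, hammingNorm (Ψ y) = 8) : ∃ t e, B.IsPlacedAt t e := by
  have φ : (Fin k → ZMod 2) ≃ₗ[ZMod 2] B :=
    LinearEquiv.ofFinrankEq _ _ (by rw [Module.finrank_fin_fun, hk])
  refine BinCode.exists_isPlacedAt t (B.subtype ∘ₗ φ.toLinearMap) ?_ Ψ hΨ ?_
  · rw [LinearMap.range_comp, LinearEquiv.range, Submodule.map_top, Submodule.range_subtype]
  · intro y
    by_cases hy : y = 0
    · rw [hy, map_zero, map_zero, hammingNorm_zero, hammingNorm_zero]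
    · rw [hw y hy]
      refine hB _ (φ y).2 fun h => hy ?_
      exact φ.map_eq_zero_iff.1 (Subtype.ext h)

/-- Any linear parametrization of `A`, with an extra coordinate for `u`, has the prescribed weights:
16 for `u` itself and 8 whenever the `A`-component is nonzero. -/
theorem exists_isPlacedAt_sup_span {A : BinCode ι} (hA : A.IsEquidistant) {u : ι → ZMod 2}
    (hu : hammingNorm u = 16) (hAu : ∀ w ∈ A, w * u = w)
    (t : TriplyEvenBlock) {k : ℕ} (hk : Module.finrank (ZMod 2) A = k)
    (Ψ : ZMod 2 × (Fin k → ZMod 2) →ₗ[ZMod 2] t.Pos → ZMod 2) (hΨ : LinearMap.range Ψ = t.code)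
    (hw : ∀ t, ∀ y ≠ 0, hammingNorm (Ψ (t, y)) = 8) (hone : hammingNorm (Ψ (1, 0)) = 16) :
    ∃ t e, IsPlacedAt (A ⊔ Submodule.span (ZMod 2) {u}) t e := by
  have φ : (Fin k → ZMod 2) ≃ₗ[ZMod 2] A :=
    LinearEquiv.ofFinrankEq _ _ (by rw [Module.finrank_fin_fun, hk])
  refine BinCode.exists_isPlacedAt t
    ((LinearMap.toSpanSingleton (ZMod 2) _ u).coprod (A.subtype ∘ₗ φ.toLinearMap)) ?_ Ψ hΨ ?_
  · rw [LinearMap.range_coprod, LinearMap.range_toSpanSingleton, LinearMap.range_comp,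
      LinearEquiv.range, Submodule.map_top, Submodule.range_subtype, sup_comm]
  · rintro ⟨s, y⟩
    rw [LinearMap.coprod_apply, LinearMap.toSpanSingleton_apply]
    change hammingNorm (s • u + (φ y : ι → ZMod 2)) = _
    by_cases hy : y = 0
    · rw [hy, map_zero, ZeroMemClass.coe_zero, add_zero]
      by_cases hs : s = 0
      · rw [hs, zero_smul, ← Prod.zero_eq_mk, map_zero, hammingNorm_zero, hammingNorm_zero]
      · rw [eq_one_of_ne_zero hs, one_smul, hu, hone]
    · have h1 : hammingNorm (φ y : ι → ZMod 2) = 8 :=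
        hA _ (φ y).2 fun h => hy (φ.map_eq_zero_iff.1 (Subtype.ext h))
      rw [hw s y hy]
      by_cases hs : s = 0
      · rw [hs, zero_smul, zero_add, h1]
      · rw [eq_one_of_ne_zero hs, one_smul, add_comm]
        have := hammingNorm_add_add (φ y : ι → ZMod 2) u
        rw [hAu _ (φ y).2, h1] at this
        omega

theorem IsBlockLike.exists_isPlacedAt {B : BinCode ι} (hB : B.IsBlockLike) :
    ∃ t e, B.IsPlacedAt t e := by
  rcases hB with ⟨hB, hbot⟩ | ⟨A, u, hA, hA2, hu, hAu, rfl⟩ | ⟨k, hk, h, h4, hd, rfl⟩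
  · have h1 := hB.finrank_le
    have h2 : Module.finrank (ZMod 2) B ≠ 0 := by
      rwa [Ne, Submodule.finrank_eq_zero]
    have hcases : Module.finrank (ZMod 2) B = 1 ∨ Module.finrank (ZMod 2) B = 2 ∨
        Module.finrank (ZMod 2) B = 3 ∨ Module.finrank (ZMod 2) B = 4 := by omega
    rcases hcases with hk | hk | hk | hk
    · refine hB.exists_isPlacedAt (.fourTimesParity 1 le_rfl) hk _
        (range_parityMap 1 ▸ range_funLeft_comp 4 (parityMap 1)) ?_
      intro y hy
      refine (hammingNorm_funLeft_snd 4 (parityMap 1 y)).trans ?_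
      have : ∀ y ≠ 0, hammingNorm (parityMap 1 y) = 2 := by decide
      rw [this y hy]
    · refine hB.exists_isPlacedAt (.fourTimesParity 2 (by norm_num)) hk _
        (range_parityMap 2 ▸ range_funLeft_comp 4 (parityMap 2)) ?_
      intro y hy
      refine (hammingNorm_funLeft_snd 4 (parityMap 2 y)).trans ?_
      have : ∀ y ≠ 0, hammingNorm (parityMap 2 y) = 2 := by decide
      rw [this y hy]
    · refine hB.exists_isPlacedAt .twiceSimplexThree hk _
        (range_simplexMap 3 ▸ range_funLeft_comp 2 (simplexMap 3)) ?_
      intro y hy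
      refine (hammingNorm_funLeft_snd 2 (simplexMap 3 y)).trans ?_
      have := hammingNorm_simplexMap hy
      omega
    · refine hB.exists_isPlacedAt .simplexFour hk (simplexMap 4) (range_simplexMap 4) ?_
      intro y hy
      have := hammingNorm_simplexMap hy
      change hammingNorm (simplexMap 4 y) = 8
      omega
  · have h1 := hA.finrank_le
    have hcases : Module.finrank (ZMod 2) A = 2 ∨
        Module.finrank (ZMod 2) A = 3 ∨ Module.finrank (ZMod 2) A = 4 := by omega
    rcases hcases with hk | hk | hk
    · have h2 : ∀ (t : ZMod 2) (y : Fin 2 → ZMod 2), y ≠ 0 →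
          hammingNorm ![t + y 0 + y 1, t + y 0, t + y 1, t] = 2 := by decide
      refine exists_isPlacedAt_sup_span hA hu hAu (.fourTimesParity 3 (by norm_num)) hk _
        (range_parityThreeMap ▸ range_funLeft_comp 4 parityThreeMap) ?_ ?_
      · intro t y hy
        refine (hammingNorm_funLeft_snd 4 (parityThreeMap (t, y))).trans ?_
        rw [parityThreeMap_apply, h2 t y hy]
      · refine (hammingNorm_funLeft_snd 4 (parityThreeMap (1, 0))).trans ?_
        rw [parityThreeMap_apply]
        decide
    · refine exists_isPlacedAt_sup_span hA hu hAu .twiceReedMullerFour hk _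
        (range_reedMullerMap 3 ▸ range_funLeft_comp 2 (reedMullerMap 3)) ?_ ?_
      · intro t y hy
        refine (hammingNorm_funLeft_snd 2 (reedMullerMap 3 (t, y))).trans ?_
        have := hammingNorm_reedMullerMap t hy
        omega
      · refine (hammingNorm_funLeft_snd 2 (reedMullerMap 3 (1, 0))).trans ?_
        rw [hammingNorm_reedMullerMap_one]
        norm_num
    · refine exists_isPlacedAt_sup_span hA hu hAu .reedMullerFive hk (reedMullerMap 4)
        (range_reedMullerMap 4) ?_ ?_
      · intro t y hy
        have := hammingNorm_reedMullerMap t hy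
        change hammingNorm (reedMullerMap 4 (t, y)) = 8
        omega
      · exact (hammingNorm_reedMullerMap_one 4).trans (by norm_num)
  -- The parity check code parametrizes both sides; each coefficient equal to 1 contributes weight 4
  -- on either side.
  · refine BinCode.exists_isPlacedAt (.fourTimesParity k (by omega))
      (Fintype.linearCombination (ZMod 2) h ∘ₗ (parityCheck k).subtype) ?_
      (LinearMap.funLeft (ZMod 2) (ZMod 2) (Prod.snd : Fin 4 × Fin (k + 1) → Fin (k + 1)) ∘ₗ
        (parityCheck k).subtype) ?_ ?_
    · rw [LinearMap.range_comp, Submodule.range_subtype]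
    · exact (range_funLeft_comp 4 (parityCheck k).subtype).trans (by
        rw [Submodule.range_subtype]; rfl)
    · intro y
      refine Eq.trans ?_ (hammingNorm_funLeft_snd 4 y.1).symm
      rw [LinearMap.comp_apply, Fintype.linearCombination_apply, hammingNorm_sum]
      · rw [hammingNorm_eq_sum_val y.1, Finset.mul_sum]
        refine Finset.sum_congr rfl fun i _ => ?_
        rw [Submodule.subtype_apply]
        by_cases hy : y.1 i = 0
        · rw [hy, zero_smul, hammingNorm_zero, ZMod.val_zero, mul_zero]
        · rw [eq_one_of_ne_zero hy, one_smul, h4, ZMod.val_one, mul_one]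
      · intro i j hij
        rw [smul_mul_smul_comm, hd i j hij, smul_zero]

end Blocks

/-! ### Assembling blocks into a direct sum -/

section Assembly

variable {ι : Type}

/-- The code `C` is the direct sum of building blocks placed at pairwise disjoint sets of
positions, extended by zeros. -/
def IsPlacedFamily (C : BinCode ι) {r : ℕ} (F : Fin r → (t : TriplyEvenBlock) × (t.Pos → ι)) :
    Prop :=
  Function.Injective (fun p : (s : Fin r) × (F s).1.Pos => (F p.1).2 p.2) ∧
    ∀ x, x ∈ C ↔ (∀ s, (fun p => x ((F s).2 p)) ∈ (F s).1.code) ∧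
      ∀ i, (∀ s p, (F s).2 p ≠ i) → x i = 0

theorem IsPlacedAt.exists_ne_zero {B : BinCode ι} {t : TriplyEvenBlock} {e : t.Pos → ι}
    (h : B.IsPlacedAt t e) (p : t.Pos) : ∃ w ∈ B, w (e p) ≠ 0 := by
  obtain ⟨c, hc, -, hcp, -⟩ := exists_codeword_weight_eight t p p
  refine ⟨Function.extend e c 0, ?_, by rwa [h.1.extend_apply]⟩
  rw [h.2]
  constructor
  · simp_rw [h.1.extend_apply]
    exact hc
  · intro i hi
    exact Function.extend_apply' _ _ _ hi

theorem IsPlacedFamily.eq_of_apply_eq {C : BinCode ι} {r : ℕ}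
    {F : Fin r → (t : TriplyEvenBlock) × (t.Pos → ι)} (h : C.IsPlacedFamily F) {s s' : Fin r}
    {p : (F s).1.Pos} {p' : (F s').1.Pos} (hp : (F s).2 p = (F s').2 p') : s = s' :=
  congrArg Sigma.fst (h.1 (a₁ := ⟨s, p⟩) (a₂ := ⟨s', p'⟩) hp)

theorem IsPlacedFamily.injective {C : BinCode ι} {r : ℕ}
    {F : Fin r → (t : TriplyEvenBlock) × (t.Pos → ι)} (h : C.IsPlacedFamily F) (s : Fin r) :
    Function.Injective (F s).2 := fun p p' hp =>
  eq_of_heq (Sigma.mk.inj_iff.1 (h.1 (a₁ := ⟨s, p⟩) (a₂ := ⟨s, p'⟩) hp)).2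

theorem IsPlacedFamily.extend_mem {C : BinCode ι} {r : ℕ}
    {F : Fin r → (t : TriplyEvenBlock) × (t.Pos → ι)} (h : C.IsPlacedFamily F) (s : Fin r)
    {c : (F s).1.Pos → ZMod 2} (hc : c ∈ (F s).1.code) : Function.extend (F s).2 c 0 ∈ C := by
  rw [h.2]
  constructor
  · intro s'
    by_cases hss : s' = s
    · subst hss
      simp_rw [(h.injective s').extend_apply]
      exact hc
    · convert Submodule.zero_mem _ using 1
      ext q
      refine Function.extend_apply' _ _ _ ?_
      rintro ⟨q', hq'⟩
      exact hss (h.eq_of_apply_eq hq').symm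
  · intro i hi
    refine Function.extend_apply' _ _ _ ?_
    rintro ⟨q, hq⟩
    exact hi s q hq

theorem IsPlacedFamily.exists_ne_zero {C : BinCode ι} {r : ℕ}
    {F : Fin r → (t : TriplyEvenBlock) × (t.Pos → ι)} (h : C.IsPlacedFamily F) (s : Fin r)
    (p : (F s).1.Pos) : ∃ w ∈ C, w ((F s).2 p) ≠ 0 := by
  obtain ⟨c, hc, -, hcp, -⟩ := exists_codeword_weight_eight (F s).1 p p
  exact ⟨_, h.extend_mem s hc, by rwa [(h.injective s).extend_apply]⟩

theorem IsPlacedFamily.cons {B D : BinCode ι} {t : TriplyEvenBlock} {e : t.Pos → ι}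
    (hB : B.IsPlacedAt t e) {r : ℕ} {F : Fin r → (t : TriplyEvenBlock) × (t.Pos → ι)}
    (hD : D.IsPlacedFamily F) (hBD : ∀ w ∈ B, ∀ x ∈ D, w * x = 0) :
    (show BinCode ι from B ⊔ D).IsPlacedFamily
      (Fin.cons (α := fun _ => (t : TriplyEvenBlock) × (t.Pos → ι)) ⟨t, e⟩ F) := by
  -- Disjointness of codewords becomes disjointness of positions, because every placed position is
  -- nonzero in some codeword.
  have hne : ∀ p s q, e p ≠ (F s).2 q := by
    intro p s q h
    obtain ⟨w, hw, hwp⟩ := hB.exists_ne_zero p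
    obtain ⟨x, hx, hxq⟩ := hD.exists_ne_zero s q
    rw [h] at hwp
    exact mul_ne_zero hwp hxq (congrFun (hBD w hw x hx) _)
  constructor
  · rintro ⟨s, p⟩ ⟨s', p'⟩
    induction s using Fin.cases <;> induction s' using Fin.cases
    · intro h
      have h' : e p = e p' := h
      have := hB.1 h'
      subst this
      rfl
    · intro h
      exact absurd h (hne p _ p')
    · intro h
      exact absurd h.symm (hne p' _ p)
    · rename_i s s'
      intro h
      have h' := hD.1 (a₁ := ⟨s, p⟩) (a₂ := ⟨s', p'⟩) h
      have hs := congrArg Sigma.fst h'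
      dsimp only at hs
      subst hs
      have hp : p = p' := eq_of_heq (Sigma.mk.inj_iff.1 h').2
      subst hp
      rfl
  · intro x
    rw [Fin.forall_fin_succ]
    change x ∈ B ⊔ D ↔ ((fun p => x (e p)) ∈ t.code ∧ ∀ s, (fun p => x ((F s).2 p)) ∈
      (F s).1.code) ∧ _
    have hoff : ∀ i, (∀ s p, (Fin.cons (α := fun _ => (t : TriplyEvenBlock) × (t.Pos → ι))
        ⟨t, e⟩ F s).2 p ≠ i) ↔ (i ∉ Set.range e ∧ ∀ s p, (F s).2 p ≠ i) := by
      intro i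
      rw [Fin.forall_fin_succ]
      change (∀ p, e p ≠ i) ∧ (∀ s p, (F s).2 p ≠ i) ↔ _
      simp
    simp_rw [hoff]
    rw [Submodule.mem_sup]
    constructor
    · rintro ⟨b, hb, d, hd, rfl⟩
      obtain ⟨hb1, hb2⟩ := (hB.2 b).1 hb
      obtain ⟨hd1, hd2⟩ := (hD.2 d).1 hd
      refine ⟨⟨?_, fun s => ?_⟩, ?_⟩
      · convert hb1 using 1
        ext p
        rw [Pi.add_apply, hd2 (e p) fun s q => (hne p s q).symm, add_zero]
      · convert hd1 s using 1
        ext q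
        rw [Pi.add_apply, hb2 ((F s).2 q) ?_, zero_add]
        rintro ⟨p, hp⟩
        exact hne p s q hp
      · rintro i ⟨h1, h2⟩
        rw [Pi.add_apply, hb2 i h1, hd2 i h2, add_zero]
    · rintro ⟨⟨h1, h2⟩, h3⟩
      classical
      let b : ι → ZMod 2 := fun i => if i ∈ Set.range e then x i else 0
      have hbe : ∀ p, b (e p) = x (e p) := fun p => if_pos ⟨p, rfl⟩
      have hb0 : ∀ i, i ∉ Set.range e → b i = 0 := fun i hi => if_neg hi
      refine ⟨b, ?_, x - b, ?_, by abel⟩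
      · rw [hB.2]
        simp_rw [hbe]
        exact ⟨h1, hb0⟩
      · rw [hD.2]
        constructor
        · intro s
          convert h2 s using 1
          ext q
          rw [Pi.sub_apply, hb0 _ ?_, sub_zero]
          rintro ⟨p, hp⟩
          exact hne p s q hp
        · intro i hi
          by_cases hie : i ∈ Set.range e
          · obtain ⟨p, rfl⟩ := hie
            rw [Pi.sub_apply, hbe, sub_self]
          · rw [Pi.sub_apply, hb0 i hie, h3 i ⟨hie, hi⟩, sub_zero]

theorem exists_isPlacedFamily [Fintype ι] {C : BinCode ι} (hC : C.IsTriplyEven)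
    (hspan : C.IsSpannedByWeight 8) :
    ∃ (r : ℕ) (F : Fin r → (t : TriplyEvenBlock) × (t.Pos → ι)), C.IsPlacedFamily F := by
  induction hd : Module.finrank (ZMod 2) C using Nat.strong_induction_on generalizing C with
  | _ d ih =>
    by_cases hbot : C = ⊥
    · refine ⟨0, Fin.elim0, fun p => Fin.elim0 p.1, fun x => ?_⟩
      rw [hbot, Submodule.mem_bot]
      constructor
      · rintro rfl
        exact ⟨fun s => s.elim0, fun _ _ => rfl⟩
      · intro h
        ext i
        exact h.2 i fun s => s.elim0
    · obtain ⟨B, D, hB, hD, hDspan, rfl, hBD, hlt⟩ := exists_splitting hC hspan hbot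
      obtain ⟨t, e, hte⟩ := hB.exists_isPlacedAt
      obtain ⟨r, F, hF⟩ := ih _ (hd ▸ hlt) hD hDspan rfl
      exact ⟨r + 1, _, hF.cons hte hBD⟩

theorem mem_zeroExtend_directSum {r : ℕ} {T : Fin r → TriplyEvenBlock} {z : ℕ}
    {d : ((s : Fin r) × (T s).Pos) ⊕ Fin z → ZMod 2} :
    d ∈ (directSum fun s => (T s).code).zeroExtend z ↔
      (∀ s, (fun p => d (.inl ⟨s, p⟩)) ∈ (T s).code) ∧ ∀ j, d (.inr j) = 0 := by
  rw [zeroExtend, Submodule.mem_inf, Submodule.mem_comap, directSum, Submodule.mem_iInf,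
    LinearMap.mem_ker, funext_iff]
  rfl

theorem IsPlacedFamily.exists_decomposesAs [Finite ι] {C : BinCode ι} {r : ℕ}
    {F : Fin r → (t : TriplyEvenBlock) × (t.Pos → ι)} (h : C.IsPlacedFamily F) :
    ∃ z, C.DecomposesAs (fun s => (F s).1) z := by
  classical
  have : Fintype ι := Fintype.ofFinite ι
  let E : (s : Fin r) × (F s).1.Pos → ι := fun p => (F p.1).2 p.2
  -- The zero positions are those outside the image of all the blocks.
  let σ : ι ≃ ((s : Fin r) × (F s).1.Pos) ⊕ Fin (Fintype.card ↥(Set.range E)ᶜ) :=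
    (Equiv.Set.sumCompl (Set.range E)).symm.trans
      (Equiv.sumCongr (Equiv.ofInjective E h.1).symm (Fintype.equivFin ↥(Set.range E)ᶜ))
  have hinl : ∀ p, σ (E p) = .inl p := by
    intro p
    rw [← Equiv.eq_symm_apply]
    rfl
  have hinr : ∀ j, σ.symm (.inr j) ∉ Set.range E := by
    intro j
    exact ((Fintype.equivFin ↥(Set.range E)ᶜ).symm j).2
  refine ⟨_, σ, fun d => ?_⟩
  rw [mem_zeroExtend_directSum, h.2]
  refine and_congr (forall_congr' fun s => ?_) ?_
  · refine iff_of_eq (congrArg (· ∈ (F s).1.code) (funext fun p => ?_))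
    exact (congrArg d (hinl ⟨s, p⟩)).symm
  · constructor
    · intro hd i hi
      obtain ⟨p | j, hj⟩ : ∃ q, σ i = q := ⟨_, rfl⟩
      · rw [← hinl, σ.apply_eq_iff_eq] at hj
        exact absurd hj.symm (hi p.1 p.2)
      · rw [hj, hd]
    · intro hd j
      have := hd (σ.symm (.inr j)) fun s p hsp => hinr j ⟨⟨s, p⟩, hsp⟩
      rwa [σ.apply_symm_apply] at this

end Assembly

end BinCode

/-! ### Invariants that tell the building blocks apart -/

namespace TriplyEvenBlock

/-- Two positions that no codeword separates. -/
def Unseparated (t : TriplyEvenBlock) (p q : t.Pos) : Prop :=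
  ∀ c ∈ t.code, c p = c q

theorem card_pos (t : TriplyEvenBlock) : Fintype.card t.Pos =
    match t with
    | twiceSimplexThree => 14
    | simplexFour => 15
    | twiceReedMullerFour => 16
    | reedMullerFive => 16
    | fourTimesParity k _ => 4 * (k + 1) := by
  cases t with
  | twiceSimplexThree => rfl
  | simplexFour => rfl
  | twiceReedMullerFour => rfl
  | reedMullerFive => rfl
  | fourTimesParity k hk =>
    change Fintype.card (Fin 4 × Fin (k + 1)) = _
    rw [Fintype.card_prod, Fintype.card_fin, Fintype.card_fin]

instance (t : TriplyEvenBlock) : Nonempty t.Pos := by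
  rw [← Fintype.card_pos_iff, card_pos]
  cases t <;> simp

theorem eq_of_reedMullerMap {k : ℕ} {v w : Fin k → ZMod 2}
    (h : ∀ c ∈ LinearMap.range (BinCode.reedMullerMap k), c v = c w) : v = w := by
  ext r
  have := h _ ⟨(0, Pi.single r 1), rfl⟩
  rwa [BinCode.reedMullerMap_apply, BinCode.reedMullerMap_apply, BinCode.dotFunctional_single,
    BinCode.dotFunctional_single, zero_add, zero_add] at this

theorem Unseparated.snd_eq {p q : twiceReedMullerFour.Pos}
    (h : twiceReedMullerFour.Unseparated p q) : p.2 = q.2 := by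
  refine eq_of_reedMullerMap (k := 3) fun c hc => ?_
  rw [BinCode.range_reedMullerMap] at hc
  exact h _ ⟨c, hc, rfl⟩

theorem Unseparated.eq {p q : reedMullerFive.Pos} (h : reedMullerFive.Unseparated p q) :
    p = q := by
  refine eq_of_reedMullerMap (k := 4) fun c hc => ?_
  rw [BinCode.range_reedMullerMap] at hc
  exact h _ hc

/-- Some two distinct positions are unseparated. -/
def HasTwin (t : TriplyEvenBlock) : Prop :=
  ∃ p q, p ≠ q ∧ t.Unseparated p q

/-- Some three distinct positions are unseparated. -/
def HasTriplet (t : TriplyEvenBlock) : Prop :=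
  ∃ p q q', p ≠ q ∧ p ≠ q' ∧ q ≠ q' ∧ t.Unseparated p q ∧ t.Unseparated p q'

theorem not_hasTwin_reedMullerFive : ¬ reedMullerFive.HasTwin := by
  rintro ⟨p, q, hne, h⟩
  exact hne h.eq

theorem hasTwin_twiceReedMullerFour : twiceReedMullerFour.HasTwin := by
  refine ⟨((0 : Fin 2), (0 : Fin (4 - 1) → ZMod 2)), ((1 : Fin 2), (0 : Fin (4 - 1) → ZMod 2)),
    fun h => ?_, ?_⟩
  · exact absurd (congrArg Prod.fst h) (by decide)
  · rintro _ ⟨c, -, rfl⟩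
    rfl

theorem not_hasTriplet_reedMullerFive : ¬ reedMullerFive.HasTriplet := by
  rintro ⟨p, q, q', hne, -, -, h, -⟩
  exact hne h.eq

theorem not_hasTriplet_twiceReedMullerFour : ¬ twiceReedMullerFour.HasTriplet := by
  rintro ⟨p, q, q', h1, h2, h3, h, h'⟩
  have e1 := h.snd_eq
  have e2 := h'.snd_eq
  have key : ∀ a b c : Fin 2, a = b ∨ a = c ∨ b = c := by decide
  rcases key p.1 q.1 q'.1 with h0 | h0 | h0
  · exact h1 (Prod.ext h0 e1)
  · exact h2 (Prod.ext h0 e2)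
  · exact h3 (Prod.ext h0 (e1.symm.trans e2))

theorem hasTriplet_fourTimesParity (k : ℕ) (hk : 1 ≤ k) : (fourTimesParity k hk).HasTriplet := by
  refine ⟨((0 : Fin 4), (0 : Fin (k + 1))), ((1 : Fin 4), (0 : Fin (k + 1))),
    ((2 : Fin 4), (0 : Fin (k + 1))), fun h => ?_, fun h => ?_, fun h => ?_, ?_, ?_⟩
  · exact (by decide : (0 : Fin 4) ≠ 1) (congrArg Prod.fst h)
  · exact (by decide : (0 : Fin 4) ≠ 2) (congrArg Prod.fst h)
  · exact (by decide : (1 : Fin 4) ≠ 2) (congrArg Prod.fst h)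
  · rintro _ ⟨c, -, rfl⟩
    rfl
  · rintro _ ⟨c, -, rfl⟩
    rfl

/-- The lengths are 14, 15, 16, 16 and `4(k + 1)`, so only length 16 is ambiguous. There the classes
of unseparated positions decide: `reedMullerFive` has no twins, `twiceReedMullerFour` has twins but
no triplets, and the parity block with `k = 3` has triplets. -/
theorem eq_of_equiv {t t' : TriplyEvenBlock} (φ : t.Pos ≃ t'.Pos)
    (hφ : ∀ p q, t.Unseparated p q ↔ t'.Unseparated (φ p) (φ q)) : t = t' := by
  have h1 : t.HasTwin ↔ t'.HasTwin := by
    simp only [HasTwin, ← φ.exists_congr_right, hφ, φ.injective.ne_iff]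
  have h2 : t.HasTriplet ↔ t'.HasTriplet := by
    simp only [HasTriplet, ← φ.exists_congr_right, hφ, φ.injective.ne_iff]
  have h3 := Fintype.card_congr φ
  rw [card_pos, card_pos] at h3
  cases t <;> cases t' <;> dsimp only at h3 <;>
    simp_all [not_hasTwin_reedMullerFive, hasTwin_twiceReedMullerFour,
      not_hasTriplet_reedMullerFive, not_hasTriplet_twiceReedMullerFour,
      hasTriplet_fourTimesParity] <;> omega

end TriplyEvenBlock

namespace BinCode

/-! ### Uniqueness of the decomposition -/

section Uniqueness

variable {ι : Type}

theorem hammingNorm_extend [Fintype ι] {κ : Type} [Fintype κ] {e : κ → ι} (he : Function.Injective e)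
    (c : κ → ZMod 2) : hammingNorm (Function.extend e c 0) = hammingNorm c := by
  rw [hammingNorm_eq_ncard, hammingNorm_eq_ncard, ← Set.ncard_image_of_injective _ he]
  congr 1
  ext i
  by_cases hi : ∃ p, e p = i
  · obtain ⟨p, rfl⟩ := hi
    simp [he.extend_apply, he.eq_iff]
  · simp only [Set.mem_ofPred_eq, Function.extend_apply' _ _ _ hi, Set.mem_image]
    constructor
    · intro h
      exact absurd rfl h
    · rintro ⟨p, -, hp⟩
      exact absurd ⟨p, hp⟩ hi

/-- Two positions lie in the support of a common codeword of weight `8`. -/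
def Linked [Fintype ι] (C : BinCode ι) (i j : ι) : Prop :=
  ∃ c ∈ C, hammingNorm c = 8 ∧ c i ≠ 0 ∧ c j ≠ 0

variable {C : BinCode ι} {r r' : ℕ} {F : Fin r → (t : TriplyEvenBlock) × (t.Pos → ι)}
  {F' : Fin r' → (t : TriplyEvenBlock) × (t.Pos → ι)}

theorem IsPlacedFamily.linked [Fintype ι] (h : C.IsPlacedFamily F) (s : Fin r) (p q : (F s).1.Pos) :
    C.Linked ((F s).2 p) ((F s).2 q) := by
  obtain ⟨c, hc, hc8, hcp, hcq⟩ := exists_codeword_weight_eight (F s).1 p q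
  exact ⟨_, h.extend_mem s hc, by rw [hammingNorm_extend (h.injective s), hc8],
    by rwa [(h.injective s).extend_apply], by rwa [(h.injective s).extend_apply]⟩

theorem IsPlacedFamily.exists_of_ne_zero (h : C.IsPlacedFamily F) {c : ι → ZMod 2} (hc : c ∈ C)
    {i : ι} (hi : c i ≠ 0) : ∃ s p, (F s).2 p = i := by
  by_contra! hall
  exact hi (((h.2 c).1 hc).2 i hall)

/-- Restricting a codeword of weight 8 to a block that it meets gives a nonzero codeword, of weight
at least 8 by divisibility; so the restriction is the whole word. -/
theorem IsPlacedFamily.mem_range_of_linked [Fintype ι] (h : C.IsPlacedFamily F) (hC : C.IsTriplyEven)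
    {s : Fin r} {p : (F s).1.Pos} {j : ι} (hl : C.Linked ((F s).2 p) j) :
    j ∈ Set.range (F s).2 := by
  obtain ⟨c, hc, hc8, hcp, hcj⟩ := hl
  set x := Function.extend (F s).2 (fun q => c ((F s).2 q)) 0 with hx
  have hxC : x ∈ C := h.extend_mem s (((h.2 c).1 hc).1 s)
  have hcx : c * x = x := by
    ext i
    by_cases hi : ∃ q, (F s).2 q = i
    · obtain ⟨q, rfl⟩ := hi
      rw [Pi.mul_apply, hx, (h.injective s).extend_apply]
      exact congrFun (mul_self_word c) _
    · rw [Pi.mul_apply, hx, Function.extend_apply' _ _ _ hi, Pi.zero_apply, mul_zero]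
  have hx0 : hammingNorm x ≠ 0 := by
    rw [hammingNorm_ne_zero_iff]
    intro h0
    have h1 := congrFun h0 ((F s).2 p)
    rw [hx, (h.injective s).extend_apply] at h1
    exact hcp h1
  have h8 : hammingNorm c ≤ hammingNorm (c * x) := by
    rw [hcx, hc8]
    exact Nat.le_of_dvd (Nat.pos_of_ne_zero hx0) (hC x hxC)
  by_contra hj
  have h1 := congrFun ((mul_eq_self_of_hammingNorm h8).symm.trans hcx) j
  rw [hx, Function.extend_apply' _ _ _ hj] at h1
  exact hcj h1

theorem IsPlacedFamily.exists_range_subset [Fintype ι] (h : C.IsPlacedFamily F) (h' : C.IsPlacedFamily F')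
    (hC : C.IsTriplyEven) (s : Fin r) : ∃ s', Set.range (F s).2 ⊆ Set.range (F' s').2 := by
  obtain ⟨p⟩ : Nonempty (F s).1.Pos := inferInstance
  obtain ⟨w, hw, hwp⟩ := h.exists_ne_zero s p
  obtain ⟨s', p', hp'⟩ := h'.exists_of_ne_zero hw hwp
  refine ⟨s', ?_⟩
  rintro _ ⟨q, rfl⟩
  apply h'.mem_range_of_linked hC (p := p')
  rw [hp']
  exact h.linked s p q

/-- Separation inside a block is visible in `C` alone, so two decompositions agree on it. -/
theorem IsPlacedFamily.unseparated_iff (h : C.IsPlacedFamily F) (s : Fin r)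
    (p q : (F s).1.Pos) :
    (F s).1.Unseparated p q ↔ ∀ c ∈ C, c ((F s).2 p) = c ((F s).2 q) := by
  constructor
  · intro hpq c hc
    exact hpq _ (((h.2 c).1 hc).1 s)
  · intro hpq c hc
    have := hpq _ (h.extend_mem s hc)
    rwa [(h.injective s).extend_apply, (h.injective s).extend_apply] at this

theorem IsPlacedFamily.fst_eq_of_range_eq (h : C.IsPlacedFamily F) (h' : C.IsPlacedFamily F')
    {s : Fin r} {s' : Fin r'} (hr : Set.range (F s).2 = Set.range (F' s').2) :
    (F s).1 = (F' s').1 := by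
  let φ : (F s).1.Pos ≃ (F' s').1.Pos := (Equiv.ofInjective _ (h.injective s)).trans
    ((Equiv.setCongr hr).trans (Equiv.ofInjective _ (h'.injective s')).symm)
  have hφ : ∀ p, (F' s').2 (φ p) = (F s).2 p := fun p =>
    Equiv.apply_ofInjective_symm (h'.injective s') _
  refine TriplyEvenBlock.eq_of_equiv φ fun p q => ?_
  rw [h.unseparated_iff, h'.unseparated_iff, hφ, hφ]

/-- Each block of either family lies inside a block of the other. Blocks of one family are nonempty
and pairwise disjoint, so the two assignments are mutually inverse and the inclusions are
equalities. -/
theorem IsPlacedFamily.exists_equiv [Fintype ι] (h : C.IsPlacedFamily F) (h' : C.IsPlacedFamily F')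
    (hC : C.IsTriplyEven) : ∃ e : Fin r ≃ Fin r', ∀ s, (F' (e s)).1 = (F s).1 := by
  choose e he using h.exists_range_subset h' hC
  choose e' he' using h'.exists_range_subset h hC
  have h1 : ∀ s, e' (e s) = s := by
    intro s
    obtain ⟨p⟩ : Nonempty (F s).1.Pos := inferInstance
    obtain ⟨q, hq⟩ := (he s).trans (he' _) ⟨p, rfl⟩
    exact h.eq_of_apply_eq hq
  have h2 : ∀ s, e (e' s) = s := by
    intro s
    obtain ⟨p⟩ : Nonempty (F' s).1.Pos := inferInstance
    obtain ⟨q, hq⟩ := (he' s).trans (he _) ⟨p, rfl⟩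
    exact h'.eq_of_apply_eq hq
  refine ⟨⟨e, e', h1, h2⟩, fun s => (h.fst_eq_of_range_eq h' ?_).symm⟩
  refine (he s).antisymm ?_
  have := he' (e s)
  rwa [h1] at this

/-- The formula for `z` refers to `C` only, because no position of a block is zero in all codewords;
this settles the uniqueness of `z`. -/
theorem DecomposesAs.exists_isPlacedFamily {T : Fin r → TriplyEvenBlock} {z : ℕ}
    (h : C.DecomposesAs T z) :
    ∃ e : (s : Fin r) → (T s).Pos → ι, C.IsPlacedFamily (fun s => ⟨T s, e s⟩) ∧
      z = Set.ncard {i | ∀ c ∈ C, c i = 0} := by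
  obtain ⟨σ, hσ⟩ := h
  have hfam : C.IsPlacedFamily (fun s => ⟨T s, fun p => σ.symm (.inl ⟨s, p⟩)⟩) := by
    constructor
    · rintro ⟨s, p⟩ ⟨s', p'⟩ h
      exact Sum.inl_injective (σ.symm.injective h)
    · intro x
      have h1 := hσ fun q => x (σ.symm q)
      simp_rw [σ.symm_apply_apply] at h1
      rw [← h1, mem_zeroExtend_directSum]
      refine and_congr Iff.rfl ?_
      constructor
      · intro hx i hi
        obtain ⟨⟨s, p⟩ | j, hj⟩ : ∃ q, σ i = q := ⟨_, rfl⟩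
        · exact absurd ((σ.symm_apply_eq).2 hj.symm) (hi s p)
        · rw [← (σ.symm_apply_eq).2 hj.symm]
          exact hx j
      · intro hx j
        refine hx _ fun s p h => ?_
        cases σ.symm.injective h
  refine ⟨_, hfam, ?_⟩
  have hset : {i | ∀ c ∈ C, c i = 0} = Set.range fun j : Fin z => σ.symm (.inr j) := by
    ext i
    rw [Set.mem_ofPred_eq]
    constructor
    · intro hi
      obtain ⟨⟨s, p⟩ | j, hj⟩ : ∃ q, σ i = q := ⟨_, rfl⟩
      · obtain ⟨w, hw, hwp⟩ := hfam.exists_ne_zero s p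
        rw [← (σ.symm_apply_eq).2 hj.symm] at hi
        exact absurd (hi w hw) hwp
      · exact ⟨j, (σ.symm_apply_eq).2 hj.symm⟩
    · rintro ⟨j, rfl⟩ c hc
      refine ((hfam.2 c).1 hc).2 _ fun s p h => ?_
      cases σ.symm.injective h
  rw [hset, Set.ncard_range_of_injective fun _ _ h => Sum.inr_injective (σ.symm.injective h),
    Nat.card_eq_fintype_card, Fintype.card_fin]

end Uniqueness

end BinCode

theorem mainTheorem7 (n : ℕ) (C : BinCode (Fin n))
    (hdiv : C.IsTriplyEven) (hspan : C.IsSpannedByWeight 8) :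
    (∃ (r : ℕ) (T : Fin r → TriplyEvenBlock) (z : ℕ), C.DecomposesAs T z) ∧
      (∀ (r r' : ℕ) (T : Fin r → TriplyEvenBlock) (T' : Fin r' → TriplyEvenBlock) (z z' : ℕ),
        C.DecomposesAs T z → C.DecomposesAs T' z' →
          z = z' ∧ ∃ e : Fin r ≃ Fin r', ∀ s : Fin r, T' (e s) = T s) := by
  constructor
  · obtain ⟨r, F, hF⟩ := BinCode.exists_isPlacedFamily hdiv hspan
    obtain ⟨z, hz⟩ := hF.exists_decomposesAs
    exact ⟨r, _, z, hz⟩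
  · intro r r' T T' z z' h h'
    obtain ⟨e, he, rfl⟩ := h.exists_isPlacedFamily
    obtain ⟨e', he', rfl⟩ := h'.exists_isPlacedFamily
    exact ⟨rfl, he.exists_equiv he' hdiv⟩
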